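/- Let $G$ be a finite group such that every maximal subgroup $M$ of $G$ is nilpotent or has index $|G:M|$ equal to a prime or to the square of a prime. Then $G$ is solvable. -/

import Mathlib

/-! Quotients of G inherit the hypothesis, so by induction it suffices that a minimal normal
subgroup N is solvable. Suppose not. Let p be the largest prime divisor of |N|, which is odd, and T
a Sylow p-subgroup of N. A maximal subgroup M containing N_G(T) satisfies MN = G by the Frattini
argument, so |G : M| = |N : M ∩ N| is congruent to 1 mod p. No prime q ≤ p is, and q² is only for q
= 2, p = 3, when N embeds into the symmetric group of degree 4. Hence M is nilpotent. It normalizes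
T, and by maximality it is the normalizer of both Ω₁(Z(T)) and J(T). Thompson's theorem then makes N
p-nilpotent, against minimality.

Thompson's theorem (`pNilpotent_of_sylowLocal`) says that, for odd p, a group is p-nilpotent if the
normalizers of Ω₁(Z(S)) and J(S) are, for S a Sylow p-subgroup. In a minimal counterexample X,
Frobenius' criterion (`pNilpotent_of_normalizer`, by fusion and transfer) yields U = O_p(X) ≠ 1;
moreover X/U is p-nilpotent, C(U) ≤ U, and proper subgroups of index prime to p are p-groups. Let W
= Ω₁(Z(U)). If an abelian subgroup A of S of maximal order were not contained in U, then |A : A ∩ U|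
< |W : C_W(A)|, and the abelian group (A ∩ U)W would be larger than A. So J(S) = J(U) is normal in
X, a contradiction.

The inequality (`relIndex_mul_card_inf_centralizer_lt`) comes from linear algebra. Over an
algebraically closed field, W splits into weight spaces for an abelian p'-group of automorphisms,
and A permutes the weights. An orbit of length n contributes a factor at most n to the order of the
permutation group and at least n - 1 to the codimension of the fixed vectors, and n < p^(n-1) for n
≥ 2, p ≥ 3. -/

/-! ### Elements of order prime to `p` and `p`-nilpotent groups -/

/-- The order of `x` is prime to `p`. -/
def PRegular (p : ℕ) {X : Type*} [Group X] (x : X) : Prop := (orderOf x).Coprime p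

/-- A group is `p`-nilpotent if its elements of order prime to `p` are closed under
multiplication. -/
def PNilpotent (p : ℕ) (X : Type*) [Group X] : Prop :=
  ∀ x y : X, PRegular p x → PRegular p y → PRegular p (x * y)

section PRegular

variable {p : ℕ} {X Y : Type*} [Group X] [Group Y]

theorem pRegular_one : PRegular p (1 : X) := by simp [PRegular]

theorem PRegular.inv {x : X} (h : PRegular p x) : PRegular p x⁻¹ := by
  simpa [PRegular] using h

theorem PRegular.conj {x : X} (h : PRegular p x) (g : X) : PRegular p (g * x * g⁻¹) := by
  have : orderOf (g * x * g⁻¹) = orderOf x :=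
    orderOf_injective (MulAut.conj g).toMonoidHom (MulAut.conj g).injective x
  rwa [PRegular, this]

theorem PRegular.map {x : X} (h : PRegular p x) (f : X →* Y) : PRegular p (f x) :=
  Nat.Coprime.coprime_dvd_left (orderOf_map_dvd f x) h

theorem pRegular_map_iff {f : X →* Y} (hf : Function.Injective f) {x : X} :
    PRegular p (f x) ↔ PRegular p x := by
  rw [PRegular, PRegular, orderOf_injective f hf]

theorem pRegular_coe {H : Subgroup X} {x : H} : PRegular p (x : X) ↔ PRegular p x :=
  pRegular_map_iff H.subtype_injective

theorem PRegular.of_pow {x : X} {n : ℕ} (hn : n.Coprime p) (h : x ^ n = 1) : PRegular p x :=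
  Nat.Coprime.coprime_dvd_left (orderOf_dvd_of_pow_eq_one h) hn

theorem PRegular.eq_one {x : X} (h : PRegular p x) {k : ℕ} (hk : x ^ p ^ k = 1) : x = 1 := by
  rw [← orderOf_eq_one_iff]
  exact Nat.Coprime.eq_one_of_dvd (Nat.Coprime.pow_right k h) (orderOf_dvd_of_pow_eq_one hk)

theorem PRegular.eq_one_of_mem {x : X} (h : PRegular p x) {H : Subgroup X} (hH : IsPGroup p H)
    (hx : x ∈ H) : x = 1 := by
  obtain ⟨k, hk⟩ := isPGroup_iff_pow_pow_eq_one.1 hH ⟨x, hx⟩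
  exact h.eq_one (k := k) (by simpa using congrArg Subtype.val hk)

theorem exists_pow_pRegular [Finite X] (hp : p.Prime) (x : X) :
    ∃ a m : ℕ, m.Coprime p ∧ (x ^ p ^ a) ^ m = 1 := by
  obtain ⟨a, m, hm, h⟩ := Nat.exists_eq_pow_mul_and_not_dvd (orderOf_pos x).ne' p hp.ne_one
  exact ⟨a, m, ((Nat.Prime.coprime_iff_not_dvd hp).2 hm).symm, by
    rw [← pow_mul, ← h, pow_orderOf_eq_one]⟩

/-- A power x^(p^a) kills the p-part of x; as p^a is invertible modulo the order of f x, a further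
power restores the image. -/
theorem exists_pRegular_map_eq [Finite X] (hp : p.Prime) (f : X →* Y) (x : X)
    (h : PRegular p (f x)) : ∃ k : ℕ, PRegular p (x ^ k) ∧ f (x ^ k) = f x := by
  obtain ⟨a, m, hm, hx⟩ := exists_pow_pRegular hp x
  have hc : (p ^ a).Coprime (orderOf (f x)) := (Nat.Coprime.pow_right a h).symm
  obtain ⟨j, hj⟩ : ∃ j, p ^ a * j ≡ 1 [MOD orderOf (f x)] :=
    (Nat.exists_mul_mod_eq_of_coprime 1 hc
      (orderOf_pos_iff.2 (f.isOfFinOrder (isOfFinOrder_of_finite x))).ne').imp fun _ h => h.2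
  refine ⟨p ^ a * j, ?_, ?_⟩
  · refine PRegular.of_pow hm ?_
    rw [pow_mul, ← pow_mul, mul_comm j m, pow_mul, hx, one_pow]
  · rw [map_pow]
    conv_rhs => rw [← pow_one (f x)]
    exact pow_eq_pow_iff_modEq.2 hj

theorem isPGroup_of_pRegular_eq_one [Finite X] (hp : p.Prime) {H : Subgroup X}
    (h : ∀ x ∈ H, PRegular p x → x = 1) : IsPGroup p H := by
  rw [isPGroup_iff_pow_pow_eq_one]
  rintro ⟨x, hx⟩
  obtain ⟨a, m, hm, h1⟩ := exists_pow_pRegular hp x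
  exact ⟨a, Subtype.ext (by simpa using h _ (pow_mem hx _) (PRegular.of_pow hm h1))⟩

theorem pRegular_of_not_dvd_card [Finite X] (hp : p.Prime) {H : Subgroup X}
    (h : ¬ p ∣ Nat.card H) {x : X} (hx : x ∈ H) : PRegular p x := by
  have h1 : orderOf x ∣ Nat.card H := by
    have := orderOf_dvd_natCard (⟨x, hx⟩ : H)
    rwa [← Subgroup.orderOf_coe] at this
  exact (((Nat.Prime.coprime_iff_not_dvd hp).2 h).coprime_dvd_right h1).symm

theorem not_dvd_card_of_pRegular [Finite X] (hp : p.Prime) {H : Subgroup X}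
    (h : ∀ x ∈ H, PRegular p x) : ¬ p ∣ Nat.card H := by
  intro hd
  have := Fact.mk hp
  obtain ⟨x, hx⟩ := exists_prime_orderOf_dvd_card' p hd
  have := h x x.2
  rw [PRegular, Subgroup.orderOf_coe, hx, Nat.coprime_self] at this
  exact hp.ne_one this

namespace PNilpotent

theorem of_injective {f : X →* Y} (hf : Function.Injective f) (h : PNilpotent p Y) :
    PNilpotent p X := fun x y hx hy => by
  rw [← pRegular_map_iff hf, map_mul]
  exact h _ _ (hx.map f) (hy.map f)

theorem pRegular_mul {H : Subgroup X} (h : PNilpotent p H) {x y : X} (hx : x ∈ H) (hy : y ∈ H)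
    (h1 : PRegular p x) (h2 : PRegular p y) : PRegular p (x * y) :=
  pRegular_coe.2 (h ⟨x, hx⟩ ⟨y, hy⟩ (pRegular_coe.1 h1) (pRegular_coe.1 h2))

theorem mono {H K : Subgroup X} (hHK : H ≤ K) (h : PNilpotent p K) : PNilpotent p H :=
  of_injective (Subgroup.inclusion_injective hHK) h

theorem normalizer_of_map {f : Y →* X} (hf : Function.Injective f) (U : Subgroup Y)
    (h : PNilpotent p (Subgroup.normalizer (U.map f : Set X))) :
    PNilpotent p (Subgroup.normalizer (U : Set Y)) := by
  refine of_injective (f := (f.comp (Subgroup.normalizer (U : Set Y)).subtype).codRestrict _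
    fun x => Subgroup.le_normalizer_map f ⟨x, x.2, rfl⟩) (fun x y hxy => ?_) h
  exact Subtype.ext (hf (congrArg Subtype.val hxy))

theorem of_surjective [Finite X] (hp : p.Prime) {f : X →* Y} (hf : Function.Surjective f)
    (h : PNilpotent p X) : PNilpotent p Y := fun x y hx hy => by
  obtain ⟨a, rfl⟩ := hf x
  obtain ⟨b, rfl⟩ := hf y
  obtain ⟨k, h1, h2⟩ := exists_pRegular_map_eq hp f a hx
  obtain ⟨l, h3, h4⟩ := exists_pRegular_map_eq hp f b hy
  rw [← h2, ← h4, ← map_mul]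
  exact (h _ _ h1 h3).map f

theorem map [Finite X] (hp : p.Prime) (f : X →* Y) {H : Subgroup X} (h : PNilpotent p H) :
    PNilpotent p (H.map f) :=
  h.of_surjective hp (f.subgroupMap_surjective H)

/-- A group is `p`-nilpotent if it is so modulo a normal subgroup of order prime to `p`. -/
theorem of_ker {f : X →* Y} {n : ℕ} (hn : n.Coprime p) (hk : ∀ x, f x = 1 → x ^ n = 1)
    (h : PNilpotent p Y) : PNilpotent p X := fun x y hx hy => by
  have h1 := h _ _ (hx.map f) (hy.map f)
  rw [← map_mul] at h1
  refine PRegular.of_pow (n := orderOf (f (x * y)) * n) (Nat.Coprime.mul_left h1 hn) ?_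
  rw [pow_mul]
  exact hk _ (by rw [map_pow, pow_orderOf_eq_one])

/-- The subgroup of elements of order prime to `p`. -/
def complement (h : PNilpotent p X) : Subgroup X where
  carrier := {x | PRegular p x}
  mul_mem' := fun hx hy => h _ _ hx hy
  one_mem' := pRegular_one
  inv_mem' := fun hx => PRegular.inv hx

instance complement_normal (h : PNilpotent p X) : h.complement.Normal :=
  ⟨fun _ hx g => PRegular.conj hx g⟩

theorem not_dvd_card_complement [Finite X] (hp : p.Prime) (h : PNilpotent p X) :
    ¬ p ∣ Nat.card h.complement := not_dvd_card_of_pRegular hp fun _ hx => hx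

theorem isPGroup_quotient_complement [Finite X] (hp : p.Prime) (h : PNilpotent p X) :
    IsPGroup p (X ⧸ h.complement) := by
  rw [isPGroup_iff_pow_pow_eq_one]
  intro g
  obtain ⟨x, rfl⟩ := QuotientGroup.mk_surjective g
  obtain ⟨a, m, hm, h1⟩ := exists_pow_pRegular hp x
  refine ⟨a, ?_⟩
  rw [← QuotientGroup.mk_pow, QuotientGroup.eq_one_iff]
  exact PRegular.of_pow hm h1

theorem complement_sup_sylow [Finite X] [hp : Fact p.Prime] (h : PNilpotent p X)
    (S : Sylow p X) : h.complement ⊔ S = ⊤ := by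
  rw [← Subgroup.index_eq_one]
  have h1 : (h.complement ⊔ (S : Subgroup X)).index ∣ h.complement.index :=
    Subgroup.index_dvd_of_le le_sup_left
  have h2 : (h.complement ⊔ (S : Subgroup X)).index ∣ (S : Subgroup X).index :=
    Subgroup.index_dvd_of_le le_sup_right
  obtain ⟨n, hn⟩ := IsPGroup.iff_card.1 (h.isPGroup_quotient_complement hp.out)
  rw [Subgroup.index_eq_card h.complement, hn] at h1
  have h3 : (p ^ n).Coprime (S : Subgroup X).index :=
    Nat.Coprime.pow_left n ((Nat.Prime.coprime_iff_not_dvd hp.out).2 S.not_dvd_index)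
  exact Nat.eq_one_of_dvd_coprimes h3 h1 h2

theorem exists_smul_sylow_eq [Finite X] [hp : Fact p.Prime] (h : PNilpotent p X)
    (S T : Sylow p X) : ∃ k : X, PRegular p k ∧ k • S = T := by
  obtain ⟨g, rfl⟩ := MulAction.exists_smul_eq X S T
  have hg : g ∈ h.complement ⊔ (S : Subgroup X) := by rw [h.complement_sup_sylow]; trivial
  obtain ⟨k, hk, s, hs, rfl⟩ := Subgroup.mem_sup_of_normal_left.1 hg
  refine ⟨k, hk, ?_⟩
  rw [mul_smul, Sylow.smul_eq_iff_mem_normalizer.2 (Subgroup.le_normalizer hs)]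

/-- The commutator of k and d lies in the p-group D and is a product of the p-regular elements k and
d k⁻¹ d⁻¹, so it is trivial. -/
theorem mem_centralizer {D : Subgroup X} (hD : IsPGroup p D)
    (h : PNilpotent p (Subgroup.normalizer (D : Set X))) {k : X}
    (hk : k ∈ Subgroup.normalizer (D : Set X)) (hk' : PRegular p k) :
    k ∈ Subgroup.centralizer (D : Set X) := by
  rw [Subgroup.mem_centralizer_iff]
  intro d hd
  have hdN := Subgroup.le_normalizer (H := D) hd
  have h1 : k * (d * k⁻¹ * d⁻¹) = 1 := by
    refine PRegular.eq_one_of_mem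
      (h.pRegular_mul hk (mul_mem (mul_mem hdN (inv_mem hk)) (inv_mem hdN)) hk' (hk'.inv.conj d)) hD ?_
    have := (Subgroup.mem_normalizer_iff.1 hk d).1 hd
    simpa [mul_assoc] using mul_mem this (inv_mem hd)
  rw [← mul_assoc, ← mul_assoc, mul_inv_eq_one, mul_inv_eq_iff_eq_mul] at h1
  exact h1.symm

theorem of_isNilpotent [Finite X] (hp : p.Prime) [h : Group.IsNilpotent X] :
    PNilpotent p X := by
  -- A finite nilpotent group is the direct product of its Sylow subgroups; p-regular means trivial
  -- p-components, a condition closed under products.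
  obtain ⟨e⟩ := (Group.isNilpotent_of_finite_tfae (G := X).out 0 4 rfl rfl).1 h
  have key (x : X) : PRegular p x ↔
      ∀ q : (Nat.card X).primeFactors, (q : ℕ) = p → ∀ P, e.symm x q P = 1 := by
    constructor
    · rintro hx q rfl P
      have h1 := hx.map e.symm.toMonoidHom
      have h2 := (h1.map (Pi.evalMonoidHom _ q)).map (Pi.evalMonoidHom _ P)
      obtain ⟨k, hk⟩ := isPGroup_iff_pow_pow_eq_one.1 P.isPGroup' (e.symm x q P)
      exact h2.eq_one hk
    · intro hx
      obtain ⟨a, m, hm, h1⟩ := exists_pow_pRegular hp x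
      refine PRegular.of_pow hm ?_
      rw [← e.symm.map_eq_one_iff]
      funext q P
      by_cases hq : (q : ℕ) = p
      · simp [hx q hq P]
      · have hqp : (q : ℕ).Prime := Nat.prime_of_mem_primeFactors q.2
        obtain ⟨k, hk⟩ := isPGroup_iff_pow_pow_eq_one.1 P.isPGroup' (e.symm (x ^ m) q P)
        have h2 : (e.symm (x ^ m) q P) ^ p ^ a = 1 := by
          rw [← pow_mul, mul_comm, pow_mul] at h1
          have := congrFun (congrFun (congrArg e.symm h1) q) P
          simpa using this
        have h3 : PRegular (q : ℕ) (e.symm (x ^ m) q P) :=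
          PRegular.of_pow (((Nat.coprime_primes hp hqp).2 (Ne.symm hq)).pow_left a) h2
        exact h3.eq_one hk
  intro x y hx hy
  rw [key] at *
  intro q hq P
  simp [hx q hq P, hy q hq P]

end PNilpotent

end PRegular

/-! ### Frobenius' criterion for `p`-nilpotency -/

section Frobenius

open Subgroup

variable {p : ℕ} {X : Type*} [Group X]

theorem IsPGroup.lt_inf_normalizer [Finite X] [Fact p.Prime] {D P : Subgroup X}
    (hP : IsPGroup p P) (hD : D < P) : D < P ⊓ normalizer (D : Set X) := by
  have := hP.isNilpotent
  have h1 : D.subgroupOf P < ⊤ := by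
    rw [lt_top_iff_ne_top, Ne, subgroupOf_eq_top]
    exact hD.not_ge
  obtain ⟨x, hx, hx'⟩ := SetLike.exists_of_lt (Group.normalizerCondition_of_isNilpotent _ h1)
  refine lt_of_le_of_ne (le_inf hD.le le_normalizer) fun h => hx' ?_
  rw [mem_subgroupOf, h]
  refine ⟨x.2, ?_⟩
  refine mem_normalizer_iff.2 fun y => ?_
  by_cases hy : y ∈ P
  · exact mem_normalizer_iff.1 hx ⟨y, hy⟩
  · refine ⟨fun h => absurd (hD.le h) hy, fun h => absurd ?_ hy⟩
    have := mul_mem (mul_mem (inv_mem x.2) (hD.le h)) x.2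
    simpa [mul_assoc] using this

/-- Two Sylow subgroups are conjugate under the centralizer of their intersection if all local
subgroups are `p`-nilpotent. -/
theorem exists_mem_centralizer_smul_eq [Finite X] [hp : Fact p.Prime]
    (h : ∀ U : Subgroup X, IsPGroup p U → U ≠ ⊥ → PNilpotent p (normalizer (U : Set X)))
    (P Q : Sylow p X) :
    ∃ c ∈ centralizer ((P ⊓ Q : Subgroup X) : Set X), c • P = Q := by
  induction hn : Nat.card X - Nat.card (P ⊓ Q : Subgroup X) using Nat.strong_induction_on
    generalizing P Q with
  | _ n ih =>
  have step (P' Q' : Sylow p X) (hlt : (P ⊓ Q : Subgroup X) < (P' ⊓ Q' : Subgroup X)) :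
      ∃ c ∈ centralizer ((P ⊓ Q : Subgroup X) : Set X), c • P' = Q' := by
    have h1 : Nat.card (P ⊓ Q : Subgroup X) < Nat.card (P' ⊓ Q' : Subgroup X) :=
      Set.Finite.card_lt_card (Set.toFinite _) hlt
    have h2 := card_le_card_group (P' ⊓ Q' : Subgroup X)
    obtain ⟨c, hc, hc'⟩ := ih _ (by omega) P' Q' rfl
    exact ⟨c, centralizer_le hlt.le hc, hc'⟩
  by_cases hPQ : P = Q
  · exact ⟨1, one_mem _, by rw [one_smul, hPQ]⟩
  by_cases hD : (P ⊓ Q : Subgroup X) = ⊥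
  · obtain ⟨g, hg⟩ := MulAction.exists_smul_eq X P Q
    refine ⟨g, ?_, hg⟩
    rw [hD, mem_centralizer_iff]
    simp
  set D : Subgroup X := P ⊓ Q with hDdef
  have hDp : IsPGroup p D := P.isPGroup'.to_inf_left
  have hN := h D hDp hD
  set N := normalizer (D : Set X)
  -- Normalizers grow in P and in Q, so both meet N in more than D. Sylow subgroups of N above these
  -- intersections are conjugate by a p-regular k, which centralizes D. This links P to Q through R
  -- and k • R, with larger intersections at both ends.
  have hDP : D < P := lt_of_le_of_ne inf_le_left fun he =>
    hPQ (Sylow.ext (P.is_maximal' Q.isPGroup' (inf_eq_left.1 he))).symm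
  have hDQ : D < Q := lt_of_le_of_ne inf_le_right fun he =>
    hPQ (Sylow.ext (Q.is_maximal' P.isPGroup' (inf_eq_right.1 he)))
  have hP1 := P.isPGroup'.lt_inf_normalizer hDP
  have hQ1 := Q.isPGroup'.lt_inf_normalizer hDQ
  obtain ⟨S, hS⟩ := (P.isPGroup'.comap_subtype (K := N)).exists_le_sylow
  obtain ⟨T, hT⟩ := (Q.isPGroup'.comap_subtype (K := N)).exists_le_sylow
  obtain ⟨k, hk, hkST⟩ := hN.exists_smul_sylow_eq S T
  obtain ⟨R, hR⟩ := (S.isPGroup'.map N.subtype).exists_le_sylow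
  have hPR : D < (P ⊓ R : Subgroup X) := lt_of_lt_of_le hP1 <| le_inf inf_le_left fun x hx =>
    hR ⟨⟨x, hx.2⟩, hS hx.1, rfl⟩
  have hRQ : D < (((k : X) • R : Sylow p X) : Subgroup X) ⊓ Q := by
    refine lt_of_lt_of_le hQ1 <| le_inf (fun x hx => ?_) inf_le_left
    have h1 : (⟨x, hx.2⟩ : N) ∈ T := hT hx.1
    rw [← hkST] at h1
    obtain ⟨y, hy, hy'⟩ := h1
    refine ⟨y, hR ⟨y, hy, rfl⟩, ?_⟩
    exact congrArg Subtype.val hy'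
  obtain ⟨c, hc, hcP⟩ := step P R hPR
  obtain ⟨d, hd, hdQ⟩ := step _ _ hRQ
  refine ⟨d * (k * c), mul_mem hd (mul_mem ?_ hc), by rw [mul_smul, mul_smul, hcP, hdQ]⟩
  exact hN.mem_centralizer hDp k.2 (pRegular_coe.2 hk)

/-- Fusion in a Sylow subgroup is controlled by that subgroup if all local subgroups are
`p`-nilpotent. -/
theorem exists_mem_sylow_conj_eq [Finite X] [hp : Fact p.Prime]
    (h : ∀ U : Subgroup X, IsPGroup p U → U ≠ ⊥ → PNilpotent p (normalizer (U : Set X)))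
    (P : Sylow p X) {x g : X} (hx : x ∈ P) (hg : g⁻¹ * x * g ∈ P) :
    ∃ u ∈ P, g⁻¹ * x * g = u⁻¹ * x * u := by
  by_cases hP : (P : Subgroup X) = ⊥
  · have : x = 1 := by simpa [hP] using (show x ∈ (P : Subgroup X) from hx)
    exact ⟨1, one_mem P, by simp [this]⟩
  obtain ⟨c, hc, hcP⟩ := exists_mem_centralizer_smul_eq h (g • P) P
  have hxg : x ∈ ((g • P : Sylow p X) : Subgroup X) ⊓ P :=
    ⟨⟨_, hg, by simp [mul_assoc]⟩, hx⟩
  have hcx : c * x = x * c := (mem_centralizer_iff.1 hc x hxg).symm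
  rw [← mul_smul, Sylow.smul_eq_iff_mem_normalizer] at hcP
  have hN := h P P.isPGroup' hP
  -- Since c centralizes x, conjugation by g may be replaced by c * g, which normalizes P; its
  -- p-regular factor centralizes P, leaving only u.
  have h1 : (⟨c * g, hcP⟩ : normalizer ((P : Subgroup X) : Set X)) ∈
      hN.complement ⊔ (P.subtype le_normalizer : Subgroup _) := by
    rw [hN.complement_sup_sylow]; trivial
  obtain ⟨k, hk, u, hu, hku⟩ := mem_sup_of_normal_left.1 h1
  have hku' : (k : X) * u = c * g := congrArg Subtype.val hku
  have hkx : x * k = k * x := mem_centralizer_iff.1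
    (hN.mem_centralizer P.isPGroup' k.2 (pRegular_coe.2 hk)) x hx
  refine ⟨u, hu, ?_⟩
  calc g⁻¹ * x * g = (c * g)⁻¹ * x * (c * g) := by
        simp only [mul_inv_rev, mul_assoc]
        rw [← mul_assoc x c, ← hcx]; simp [mul_assoc]
    _ = u⁻¹ * x * u := by
        rw [← hku']
        simp only [mul_inv_rev, mul_assoc]
        rw [← mul_assoc x (k : X), hkx]; simp [mul_assoc]

theorem transfer_eq_pow_index {H : Subgroup X} [H.FiniteIndex] {A : Type*} [CommGroup A]
    (φ : H →* A) {g : X} (hg : g ∈ H)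
    (hφ : ∀ x : H, ∀ g₀ : X, ∀ h : g₀⁻¹ * x * g₀ ∈ H, φ ⟨_, h⟩ = φ x) :
    φ.transfer g = φ ⟨g, hg⟩ ^ H.index := by
  classical
  let := H.fintypeQuotientOfFiniteIndex
  rw [MonoidHom.transfer_eq_prod_quotient_orbitRel_zpowers_quot, index_eq_sum_minimalPeriod H g,
    ← Finset.prod_pow_eq_pow_sum]
  refine Finset.prod_congr rfl fun q _ => ?_
  rw [← map_pow]
  exact hφ (⟨g, hg⟩ ^ _) _ _

/-- **Frobenius' normal `p`-complement theorem**. -/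
theorem pNilpotent_of_normalizer [Finite X] [hp : Fact p.Prime]
    (h : ∀ U : Subgroup X, IsPGroup p U → U ≠ ⊥ → PNilpotent p (normalizer (U : Set X))) :
    PNilpotent p X := by
  induction hn : Nat.card X using Nat.strong_induction_on generalizing X with
  | _ n ih =>
  obtain ⟨P⟩ : Nonempty (Sylow p X) := inferInstance
  by_cases hP : (P : Subgroup X) = ⊥
  · have h1 : ¬ p ∣ Nat.card X := by
      have := P.not_dvd_index
      rwa [hP, index_bot] at this
    intro x y _ _
    have h2 : ¬ p ∣ Nat.card (⊤ : Subgroup X) := by rwa [card_top]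
    exact pRegular_of_not_dvd_card hp.out h2 (mem_top _)
  set v : X →* Abelianization P := (Abelianization.of (G := P)).transfer with hv
  have hvP (x : X) (hx : x ∈ P) : v x = Abelianization.of ⟨x, hx⟩ ^ (P : Subgroup X).index := by
    refine transfer_eq_pow_index _ hx fun x g₀ hg₀ => ?_
    obtain ⟨u, hu, he⟩ := exists_mem_sylow_conj_eq h P x.2 hg₀
    have : (⟨_, hg₀⟩ : P) = (⟨u, hu⟩ : P)⁻¹ * x * ⟨u, hu⟩ := Subtype.ext he
    rw [this, map_mul, map_mul, map_inv, mul_comm, mul_inv_cancel_left]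
  -- Control of fusion makes the transfer on P the power map to an exponent prime to p; it is
  -- nontrivial because a nontrivial p-group is not perfect.
  have hker : v.ker ≠ ⊤ := by
    intro ht
    have hnil := P.isPGroup'.isNilpotent
    have : Nontrivial P := (nontrivial_iff_ne_bot _).2 hP
    have h1 : ∀ x : P, Abelianization.of x = 1 := fun x => by
      have h2 : v x = 1 := by
        rw [← MonoidHom.mem_ker, ht]; trivial
      rw [hvP x x.2] at h2
      obtain ⟨k, hk⟩ := isPGroup_iff_pow_pow_eq_one.1 P.isPGroup' x
      refine PRegular.eq_one (PRegular.of_pow (p := p) ?_ h2) (k := k)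
        (by rw [← map_pow, hk, map_one])
      exact ((Nat.Prime.coprime_iff_not_dvd hp.out).2 P.not_dvd_index).symm
    refine (Group.IsSolvable.commutator_lt_top_of_nontrivial P).ne ?_
    rw [eq_top_iff]
    intro x _
    have := h1 x
    rwa [← MonoidHom.mem_ker, Abelianization.ker_of] at this
  have hlt : Nat.card v.ker < n := by
    rw [← hn]
    refine lt_of_le_of_ne (card_le_card_group _) fun he => hker (eq_top_of_card_eq _ he)
  have hK : PNilpotent p v.ker := by
    refine ih _ hlt (fun U hU hU' => ?_) rfl
    have h1 := h (U.map v.ker.subtype) (hU.map _) (by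
      rwa [Ne, map_eq_bot_iff_of_injective _ (subtype_injective _)])
    exact h1.normalizer_of_map (subtype_injective _) U
  have hmem (x : X) (hx : PRegular p x) : x ∈ v.ker := by
    obtain ⟨k, hk⟩ := isPGroup_iff_pow_pow_eq_one.1
      (P.isPGroup'.of_surjective _ (QuotientGroup.mk'_surjective (commutator P))) (v x)
    exact (hx.map v).eq_one hk
  intro x y hx hy
  exact hK.pRegular_mul (hmem x hx) (hmem y hy) hx hy

end Frobenius

/-! ### Abelian `p`-groups permuting the weights of an abelian group of order prime to `p` -/

section Combinatorics

open MulAction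

theorem lt_pow_pred {p n : ℕ} (hp : 3 ≤ p) (hn : 2 ≤ n) : n < p ^ (n - 1) := by
  obtain ⟨m, rfl⟩ : ∃ m, n = m + 2 := ⟨n - 2, by omega⟩
  have h1 : m + 2 < 3 ^ (m + 1) := by
    induction m with
    | zero => norm_num
    | succ k ih => have := ih (by omega); rw [pow_succ]; omega
  exact h1.trans_le (Nat.pow_le_pow_left hp _)

theorem le_pow_pred {p n : ℕ} (hp : 3 ≤ p) (hn : 1 ≤ n) : n ≤ p ^ (n - 1) := by
  rcases hn.eq_or_lt with rfl | h
  · simp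
  · exact (lt_pow_pred hp h).le

/-- A commutative permutation group that is not trivial is smaller than `p ^ (n - r)`, where `n` is
its degree and `r` its number of orbits. -/
theorem card_range_toPermHom_lt {p : ℕ} (hp : 3 ≤ p) {A Λ : Type*} [Group A] [MulAction A Λ]
    [Finite Λ] (hA : ∀ a b : A, ∀ l : Λ, a • b • l = b • a • l) (hne : ∃ (a : A) (l : Λ), a • l ≠ l) :
    Nat.card (toPermHom A Λ).range * p ^ Nat.card (orbitRel.Quotient A Λ) < p ^ Nat.card Λ := by
  classical
  have := Fintype.ofFinite Λ
  have := Fintype.ofFinite (orbitRel.Quotient A Λ)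
  have hout (l : Λ) : ∃ b : A, b • (Quotient.mk'' l : orbitRel.Quotient A Λ).out = l := by
    have h1 : (Quotient.mk'' l : orbitRel.Quotient A Λ).out ∈ orbit A l :=
      Quotient.exact (Quotient.out_eq' (Quotient.mk'' l : orbitRel.Quotient A Λ))
    obtain ⟨b, hb⟩ := h1
    exact ⟨b⁻¹, by rw [← hb]; exact inv_smul_smul b l⟩
  have hmem (σ : (toPermHom A Λ).range) (ω : orbitRel.Quotient A Λ) : σ.1 ω.out ∈ ω.orbit := by
    obtain ⟨_, a, rfl⟩ := σ
    rw [orbitRel.Quotient.mem_orbit]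
    change Quotient.mk'' (a • ω.out) = ω
    conv_rhs => rw [← Quotient.out_eq' ω]
    exact Quotient.sound' (mem_orbit _ a)
  -- By commutativity, the image of one point of an orbit determines the permutation on the whole
  -- orbit.
  have h1 : Nat.card (toPermHom A Λ).range ≤ ∏ ω : orbitRel.Quotient A Λ, Nat.card ω.orbit := by
    rw [← Nat.card_pi]
    refine Nat.card_le_card_of_injective
      (fun σ ω => (⟨σ.1 ω.out, hmem σ ω⟩ : ω.orbit)) fun σ τ hst => ?_
    obtain ⟨_, a, rfl⟩ := σ
    obtain ⟨_, b, rfl⟩ := τ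
    refine Subtype.ext (Equiv.ext fun l => ?_)
    obtain ⟨c, hc⟩ := hout l
    have h2 : a • (Quotient.mk'' l : orbitRel.Quotient A Λ).out =
        b • (Quotient.mk'' l : orbitRel.Quotient A Λ).out :=
      congrArg Subtype.val (congrFun hst (Quotient.mk'' l))
    change a • l = b • l
    rw [← hc, hA, hA b, h2]
  have hsum : ∑ ω : orbitRel.Quotient A Λ, Nat.card ω.orbit = Nat.card Λ := by
    rw [Nat.card_congr (selfEquivSigmaOrbits' A Λ), Nat.card_sigma]
  have hpos (ω : orbitRel.Quotient A Λ) : 1 ≤ Nat.card ω.orbit := by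
    have : Nonempty ω.orbit := ω.nonempty_orbit.to_subtype
    exact Nat.card_pos
  obtain ⟨a, l, hal⟩ := hne
  have h2 : ∏ ω : orbitRel.Quotient A Λ, Nat.card ω.orbit <
      ∏ ω : orbitRel.Quotient A Λ, p ^ (Nat.card ω.orbit - 1) := by
    refine Finset.prod_lt_prod (fun ω _ => hpos ω) (fun ω _ => le_pow_pred hp (hpos ω))
      ⟨Quotient.mk'' l, Finset.mem_univ _, lt_pow_pred hp ?_⟩
    have : Nontrivial (orbitRel.Quotient.orbit (Quotient.mk'' l : orbitRel.Quotient A Λ)) := by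
      refine ⟨⟨⟨a • l, ?_⟩, ⟨l, ?_⟩, fun h => hal (Subtype.ext_iff.1 h)⟩⟩
      · rw [orbitRel.Quotient.mem_orbit]; exact Quotient.sound' (mem_orbit _ a)
      · rw [orbitRel.Quotient.mem_orbit]
    exact Finite.one_lt_card
  rw [Finset.prod_pow_eq_pow_sum] at h2
  refine (Nat.mul_lt_mul_of_pos_right (h1.trans_lt h2) (by positivity)).trans_le ?_
  rw [← pow_add]
  refine Nat.pow_le_pow_right (by omega) ?_
  rw [← hsum, Nat.card_eq_fintype_card, ← Finset.card_univ, Finset.card_eq_sum_ones,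
    ← Finset.sum_add_distrib]
  refine Finset.sum_le_sum fun ω _ => ?_
  have := hpos ω
  omega

end Combinatorics

/-! ### Weight spaces and the codimension of the fixed vectors -/

section Weights

open Module MulAction

variable {F V A Λ : Type*} [Field F] [AddCommGroup V] [Module F V]

theorem iSupIndep.eq_of_sum_eq {W : Λ → Submodule F V} [Fintype Λ] (hW : iSupIndep W) {f g : Λ → V}
    (hf : ∀ l, f l ∈ W l) (hg : ∀ l, g l ∈ W l) (h : ∑ l, f l = ∑ l, g l) (l : Λ) :
    f l = g l := by
  classical
  have h1 : ∑ k, (f k - g k) = 0 := by rw [Finset.sum_sub_distrib, h, sub_self]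
  rw [← Finset.add_sum_erase _ _ (Finset.mem_univ l), add_eq_zero_iff_eq_neg] at h1
  rw [← sub_eq_zero]
  refine (Submodule.disjoint_def.1 (hW l)) _ (sub_mem (hf l) (hg l)) ?_
  rw [h1]
  refine neg_mem (sum_mem fun k hk => ?_)
  exact Submodule.mem_iSup_of_mem k (Submodule.mem_iSup_of_mem (Finset.ne_of_mem_erase hk)
    (sub_mem (hf k) (hg k)))

/-- If a group permutes an independent family of nonzero subspaces, then the codimension of its
space of fixed vectors is at least the size of the family minus the number of orbits. -/
theorem finrank_invariants_add_card_le [FiniteDimensional F V]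
    [Group A] [MulAction A Λ] [Finite Λ] (ρ : A →* End F V) (W : Λ → Submodule F V)
    (hW : iSupIndep W) (hne : ∀ l, W l ≠ ⊥) (hρ : ∀ a l v, v ∈ W l → ρ a v ∈ W (a • l))
    (I : Submodule F V) (hI : ∀ v ∈ I, ∀ a, ρ a v = v) :
    finrank F I + Nat.card Λ ≤ finrank F V + Nat.card (orbitRel.Quotient A Λ) := by
  classical
  have := Fintype.ofFinite Λ
  set R : Set Λ := Set.range (Quotient.out : orbitRel.Quotient A Λ → Λ) with hR
  have hcR : Nat.card R = Nat.card (orbitRel.Quotient A Λ) :=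
    Nat.card_congr (Equiv.ofInjective _ Quotient.out_injective).symm
  have hcard : Nat.card R + Nat.card (Rᶜ : Set Λ) = Nat.card Λ := by
    exact Set.ncard_add_ncard_compl R
  set N : Submodule F V := ⨆ l, if l ∈ R then ⊥ else W l with hN
  -- The group permutes the components of a fixed vector, so they are determined by those at the
  -- orbit representatives, which vanish for vectors of N.
  have hdis : Disjoint I N := by
    rw [Submodule.disjoint_def]
    intro v hvI hvN
    obtain ⟨f, hf, hfv⟩ := (Submodule.mem_iSup_iff_exists_finsupp _ _).1 hvN
    rw [Finsupp.sum_fintype _ _ (fun _ => rfl)] at hfv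
    have hfW (l : Λ) : f l ∈ W l := by
      have := hf l
      split_ifs at this with h
      · rw [(Submodule.mem_bot F).1 this]; exact zero_mem _
      · exact this
    have hf0 (l : Λ) (hl : l ∈ R) : f l = 0 := by
      have := hf l
      rw [if_pos hl] at this
      exact (Submodule.mem_bot F).1 this
    have hfa (a : A) (l : Λ) : f (a • l) = ρ a (f l) := by
      have h1 := hW.eq_of_sum_eq (f := f) (g := fun k => ρ a (f (a⁻¹ • k))) hfW
        (fun k => by simpa using hρ a (a⁻¹ • k) _ (hfW _)) ?_ (a • l)
      · simpa using h1
      · calc ∑ k, f k = ρ a (∑ k, f k) := by rw [hfv, hI v hvI a]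
          _ = ρ a (∑ k, f (a⁻¹ • k)) :=
            congrArg _ (Equiv.sum_comp (MulAction.toPerm a⁻¹) (fun k => f k)).symm
          _ = _ := map_sum _ _ _
    rw [← hfv]
    refine Finset.sum_eq_zero fun l _ => ?_
    obtain ⟨b, hb⟩ : (Quotient.mk'' l : orbitRel.Quotient A Λ).out ∈ orbit A l :=
      Quotient.exact (Quotient.out_eq' (Quotient.mk'' l : orbitRel.Quotient A Λ))
    have h2 : l = b⁻¹ • (Quotient.mk'' l : orbitRel.Quotient A Λ).out := by
      rw [← hb]; exact (inv_smul_smul b l).symm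
    rw [h2, hfa, hf0 _ ⟨_, rfl⟩, map_zero]
  have h1 : finrank F I + finrank F N ≤ finrank F V := by
    rw [← Submodule.finrank_sup_add_finrank_inf_eq I N, hdis.eq_bot, finrank_bot, add_zero]
    exact Submodule.finrank_le _
  have h2 : Nat.card (Rᶜ : Set Λ) ≤ finrank F N := by
    choose w hw hw0 using fun l => Submodule.exists_mem_ne_zero_of_ne_bot (hne l)
    have hli : LinearIndependent F (fun l : (Rᶜ : Set Λ) => w l) :=
      (hW.comp Subtype.val_injective).linearIndependent _ (fun l => hw l) (fun l => hw0 l)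
    rw [Nat.card_eq_fintype_card, ← finrank_span_eq_card hli]
    refine Submodule.finrank_mono (Submodule.span_le.2 ?_)
    rintro _ ⟨l, rfl⟩
    refine Submodule.mem_iSup_of_mem l.1 ?_
    rw [if_neg l.2]
    exact hw l
  omega

/-- The simultaneous eigenspaces of a family of endomorphisms. -/
def weightSpace {E : Type*} (σ : E → End F V) (χ : E → F) : Submodule F V :=
  ⨅ e, (σ e).eigenspace (χ e)

theorem mem_weightSpace {E : Type*} {σ : E → End F V} {χ : E → F} {v : V} :
    v ∈ weightSpace σ χ ↔ ∀ e, σ e v = χ e • v := by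
  simp [weightSpace]

/-- Let a commuting family of diagonalizable endomorphisms be permuted by a group of automorphisms,
which acts on it as a commutative group. Then the codimension of the invariants is larger than
`log p |A : A₀|`, where `A₀` is the subgroup that fixes the family, unless `A₀ = A`. -/
theorem index_mul_pow_finrank_lt [IsAlgClosed F] [FiniteDimensional F V] [Group A] {p : ℕ}
    (hp : 3 ≤ p) {E : Type*} (σ : E → End F V) (hσ : ∀ e f, Commute (σ e) (σ f))
    (hss : ∀ e, (σ e).IsSemisimple) (α : A →* Equiv.Perm E) (hα : ∀ a b, Commute (α a) (α b))
    (ρ : A →* End F V) (hρ : ∀ a e, ρ a * σ e = σ (α a e) * ρ a)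
    (I : Submodule F V) (hI : ∀ v ∈ I, ∀ a, ρ a v = v)
    (A₀ : Subgroup A) (hA₀ : ∀ a, (∀ e, σ (α a e) = σ e) → a ∈ A₀) (hne : A₀ ≠ ⊤) :
    A₀.index * p ^ finrank F I < p ^ finrank F V := by
  have heq (χ : E → F) : ⨅ e, (σ e).maxGenEigenspace (χ e) = weightSpace σ χ :=
    iInf_congr fun e =>
      (End.isFinitelySemisimple_iff_isSemisimple.mpr (hss e)).maxGenEigenspace_eq_eigenspace _
  have hind : iSupIndep (weightSpace σ) := by
    have := End.independent_iInf_maxGenEigenspace_of_forall_mapsTo σ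
      fun i j φ => End.mapsTo_maxGenEigenspace_of_comm (hσ j i) φ
    simpa only [heq] using this
  have htop : ⨆ χ, weightSpace σ χ = ⊤ := by
    have := End.iSup_iInf_maxGenEigenspace_eq_top_of_iSup_maxGenEigenspace_eq_top_of_commute σ
      (fun i j _ => hσ i j) fun i => End.iSup_maxGenEigenspace_eq_top _
    simpa only [heq] using this
  let Λ := {χ : E → F // weightSpace σ χ ≠ ⊥}
  have hfin : Finite Λ := WellFoundedGT.finite_ne_bot_of_iSupIndep hind
  have hmap (a : A) (χ : E → F) (v : V) (hv : v ∈ weightSpace σ χ) :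
      ρ a v ∈ weightSpace σ (fun e => χ (α a⁻¹ e)) := by
    rw [mem_weightSpace] at hv ⊢
    intro e
    have h1 := LinearMap.congr_fun (hρ a (α a⁻¹ e)) v
    have h2 : α a (α a⁻¹ e) = e := by simp
    rw [h2] at h1
    change ρ a (σ _ v) = σ e (ρ a v) at h1
    rw [← h1, hv, map_smul]
  have hinj (a : A) (v : V) (h : ρ a v = 0) : v = 0 := by
    have h1 : (ρ a⁻¹ * ρ a) v = v := by rw [← map_mul, inv_mul_cancel, map_one]; rfl
    rw [← h1, Module.End.mul_apply, h, map_zero]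
  let act : MulAction A Λ :=
    { smul := fun a χ => ⟨fun e => χ.1 (α a⁻¹ e), by
        obtain ⟨v, hv, hv0⟩ := Submodule.exists_mem_ne_zero_of_ne_bot χ.2
        exact Submodule.ne_bot_iff _ |>.2 ⟨_, hmap a _ v hv, fun h => hv0 (hinj a v h)⟩⟩
      one_smul := fun χ => Subtype.ext (funext fun e => by
        change χ.1 (α 1⁻¹ e) = χ.1 e
        simp)
      mul_smul := fun a b χ => Subtype.ext (funext fun e => by
        change χ.1 (α (a * b)⁻¹ e) = χ.1 (α b⁻¹ (α a⁻¹ e))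
        simp) }
  have hsmul (a : A) (χ : Λ) (e : E) : (a • χ).1 e = χ.1 (α a⁻¹ e) := rfl
  -- If a fixes every weight, then σ e and its translate act by the same scalar on each weight
  -- space, and the weight spaces span V.
  have hker (a : A) (ha : ∀ χ : Λ, a • χ = χ) : a ∈ A₀ := by
    rw [← inv_mem_iff]
    refine hA₀ _ fun e => LinearMap.ext fun v => ?_
    have hv : v ∈ ⨆ χ, weightSpace σ χ := by rw [htop]; trivial
    induction hv using Submodule.iSup_induction' with
    | mem χ v hv =>
      by_cases h0 : weightSpace σ χ = ⊥
      · rw [h0, Submodule.mem_bot] at hv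
        simp [hv]
      · have h1 : χ (α a⁻¹ e) = χ e := congrFun (congrArg Subtype.val (ha ⟨χ, h0⟩)) e
        rw [mem_weightSpace] at hv
        rw [hv, hv, h1]
    | zero => simp
    | add x y _ _ hx hy => rw [map_add, map_add, hx, hy]
  have h1 := finrank_invariants_add_card_le ρ (fun χ : Λ => weightSpace σ χ.1)
    (hind.comp Subtype.val_injective) (fun χ => χ.2) (fun a χ v hv => hmap a χ.1 v hv) I hI
  have h2 := card_range_toPermHom_lt hp (A := A) (Λ := Λ)
    (fun a b χ => Subtype.ext (funext fun e => by
      rw [hsmul, hsmul, hsmul, hsmul, ← Equiv.Perm.mul_apply, (hα _ _).eq, Equiv.Perm.mul_apply]))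
    (by
      by_contra! hall
      exact hne (eq_top_iff.2 fun a _ => hker a (hall a)))
  have h3 : A₀.index ≤ Nat.card (toPermHom A Λ).range := by
    rw [← Subgroup.index_ker]
    have : Finite (A ⧸ (toPermHom A Λ).ker) :=
      Finite.of_equiv _ (QuotientGroup.quotientKerEquivRange (toPermHom A Λ)).symm.toEquiv
    have : (toPermHom A Λ).ker.FiniteIndex := Subgroup.finiteIndex_of_finite_quotient
    refine Nat.le_of_dvd (Nat.pos_of_ne_zero Subgroup.FiniteIndex.index_ne_zero)
      (Subgroup.index_dvd_of_le fun a ha => hker a fun χ => ?_)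
    exact Equiv.congr_fun (MonoidHom.mem_ker.1 ha) χ
  have hpp : 0 < p := by omega
  refine Nat.lt_of_mul_lt_mul_right (a := p ^ Nat.card (orbitRel.Quotient A Λ)) ?_
  calc _ = (A₀.index * p ^ Nat.card (orbitRel.Quotient A Λ)) * p ^ finrank F I := by ring
    _ ≤ (Nat.card (toPermHom A Λ).range * p ^ Nat.card (orbitRel.Quotient A Λ)) *
        p ^ finrank F I := by gcongr
    _ < p ^ Nat.card Λ * p ^ finrank F I := by gcongr
    _ = p ^ (finrank F I + Nat.card Λ) := by rw [pow_add, mul_comm]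
    _ ≤ p ^ (finrank F V + Nat.card (orbitRel.Quotient A Λ)) := Nat.pow_le_pow_right hpp h1
    _ = _ := pow_add _ _ _

end Weights

/-! ### Descent of the inequality to the prime field -/

section Linear

open Module TensorProduct

theorem Module.End.isSemisimple_of_pow_eq_one {F V : Type*} [Field F] [AddCommGroup V]
    [Module F V] {f : End F V} {n : ℕ} (hn : (n : F) ≠ 0) (h : f ^ n = 1) : f.IsSemisimple := by
  refine isSemisimple_of_squarefree_aeval_eq_zero (p := Polynomial.X ^ n - Polynomial.C 1)
    (Polynomial.separable_X_pow_sub_C 1 hn one_ne_zero).squarefree ?_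
  simp [h]

/-- Scalars are extended to an algebraic closure to obtain weights. The extended fixed space keeps
its dimension and stays fixed, and base change is injective on endomorphisms, so commutation
descends. -/
theorem index_mul_card_invariants_lt {p : ℕ} [hp : Fact p.Prime] (hp2 : p ≠ 2) {W X : Type*}
    [AddCommGroup W] [Module (ZMod p) W] [Finite W] [Group X] (θ : X →* End (ZMod p) W)
    (E : Subgroup X) [E.Normal] (A B : Subgroup X) (hA : ∀ a ∈ A, ∀ b ∈ A, a * b = b * a)
    (hE : ∀ e ∈ E, ∀ f ∈ E, Commute (θ e) (θ f))
    (hreg : ∀ e ∈ E, ∃ n : ℕ, n.Coprime p ∧ θ e ^ n = 1)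
    (hB : ∀ a ∈ A, (∀ e ∈ E, Commute (θ a) (θ e)) → a ∈ B) (hAB : ¬ A ≤ B) :
    B.relIndex A * Nat.card {w : W // ∀ a ∈ A, θ a w = w} < Nat.card W := by
  let F := AlgebraicClosure (ZMod p)
  let β : End (ZMod p) W →* End F (F ⊗[ZMod p] W) := (End.baseChangeHom (ZMod p) F W : _ →* _)
  have hβ (f : End (ZMod p) W) (w : W) : β f (1 ⊗ₜ w) = 1 ⊗ₜ f w := rfl
  have hβinj : Function.Injective β := fun f g h => LinearMap.ext fun w =>
    Module.FaithfullyFlat.tensorProduct_mk_injective (A := ZMod p) (B := F) W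
      (by simpa [hβ] using LinearMap.congr_fun h (1 ⊗ₜ w))
  let I₀ : Submodule (ZMod p) W :=
    { carrier := {w | ∀ a ∈ A, θ a w = w}
      add_mem' := fun {x y} hx hy a ha => by rw [map_add, hx a ha, hy a ha]
      zero_mem' := fun a _ => map_zero _
      smul_mem' := fun c x hx a ha => by rw [map_smul, hx a ha] }
  let α : A →* Equiv.Perm E :=
    (MulAction.toPermHom (MulAut E) E).comp ((MulAut.conjNormal (H := E)).comp A.subtype)
  have hα (a : A) (e : E) : ((α a e : E) : X) = a * e * (a : X)⁻¹ := MulAut.conjNormal_apply _ _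
  have key := index_mul_pow_finrank_lt (F := F) (V := F ⊗[ZMod p] W) (A := A) (E := E) (p := p)
    (by have := hp.out.two_le; omega) (fun e => β (θ e))
    (fun e f => (hE e e.2 f f.2).map β) (fun e => ?_) α
    (fun a b => Equiv.ext fun e => Subtype.ext ?_) ((β.comp θ).comp A.subtype)
    (fun a e => ?_) (I₀.baseChange F) (fun v hv a => ?_) (B.subgroupOf A) (fun a ha => ?_) ?_
  · have h1 : finrank F (I₀.baseChange F) = finrank (ZMod p) I₀ := by
      rw [← (Submodule.toBaseChange.toLinearEquiv F I₀).finrank_eq, finrank_baseChange]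
    rw [h1, finrank_baseChange] at key
    have h2 : Nat.card W = p ^ finrank (ZMod p) W := by
      rw [Module.natCard_eq_pow_finrank (K := ZMod p), Nat.card_zmod]
    have h3 : Nat.card I₀ = p ^ finrank (ZMod p) I₀ := by
      rw [Module.natCard_eq_pow_finrank (K := ZMod p), Nat.card_zmod]
    rw [h2]
    rw [← h3] at key
    exact key
  · obtain ⟨n, hn, h1⟩ := hreg e e.2
    refine End.isSemisimple_of_pow_eq_one (n := n) ?_ (by rw [← map_pow, h1, map_one])
    rw [Ne, CharP.cast_eq_zero_iff F p]
    intro hd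
    exact hp.out.one_lt.ne' (Nat.dvd_one.1 (hn ▸ Nat.dvd_gcd hd dvd_rfl))
  · simp only [Equiv.Perm.mul_apply, hα]
    have := hA a a.2 b b.2
    calc (a : X) * (b * e * (b : X)⁻¹) * (a : X)⁻¹ = (a * b) * e * (a * b : X)⁻¹ := by group
      _ = _ := by rw [this]; group
  · change β (θ a) * β (θ e) = β (θ (α a e : E)) * β (θ a)
    rw [← map_mul, ← map_mul, ← map_mul, ← map_mul, hα]
    simp
  · rw [Submodule.baseChange_eq_span] at hv
    induction hv using Submodule.span_induction with
    | mem v hv =>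
      obtain ⟨w, hw, rfl⟩ := hv
      exact (hβ _ _).trans (congrArg _ (hw a a.2))
    | zero => exact map_zero _
    | add x y _ _ hx hy => rw [map_add, hx, hy]
    | smul c x _ hx => rw [map_smul, hx]
  · refine hB a a.2 fun e he => ?_
    have h1 := hβinj (ha ⟨e, he⟩)
    rw [hα, map_mul, map_mul] at h1
    change θ a * θ e = θ e * θ a
    conv_rhs => rw [← h1]
    rw [mul_assoc (θ a * θ e), ← map_mul θ (a : X)⁻¹, inv_mul_cancel, map_one, mul_one]
  · rwa [Ne, Subgroup.subgroupOf_eq_top]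

end Linear

/-! ### Translation to elementary abelian groups -/

section ElementaryAbelian

open Module Subgroup
open scoped commutatorElement

/-- The version of `index_mul_card_invariants_lt` for additive endomorphisms. -/
theorem index_mul_card_addInvariants_lt {p : ℕ} [hp : Fact p.Prime] (hp2 : p ≠ 2)
    {X V : Type*} [Group X] [AddCommGroup V] [Module (ZMod p) V] [Finite V]
    (φ : X →* AddMonoid.End V) (E : Subgroup X) [E.Normal] (A B : Subgroup X)
    (hA : ∀ a ∈ A, ∀ b ∈ A, a * b = b * a)
    (hE : ∀ e ∈ E, ∀ f ∈ E, Commute (φ e) (φ f))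
    (hreg : ∀ e ∈ E, ∃ n : ℕ, n.Coprime p ∧ φ e ^ n = 1)
    (hB : ∀ a ∈ A, (∀ e ∈ E, Commute (φ a) (φ e)) → a ∈ B) (hAB : ¬ A ≤ B) :
    B.relIndex A * Nat.card {w : V // ∀ a ∈ A, φ a w = w} < Nat.card V := by
  let τ : AddMonoid.End V →* End (ZMod p) V :=
    { toFun := fun f => AddMonoidHom.toZModLinearMap p f
      map_one' := LinearMap.ext fun _ => rfl
      map_mul' := fun _ _ => LinearMap.ext fun _ => rfl }
  have hτ : Function.Injective τ := fun f g h => AddMonoidHom.ext fun w => LinearMap.congr_fun h w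
  have hcomm (x y : X) : Commute ((τ.comp φ) x) ((τ.comp φ) y) ↔ Commute (φ x) (φ y) :=
    ⟨fun h => hτ ((map_mul τ _ _).trans (h.eq.trans (map_mul τ _ _).symm)), fun h => h.map τ⟩
  exact index_mul_card_invariants_lt hp2 (τ.comp φ) E A B hA
    (fun e he f hf => (hcomm e f).2 (hE e he f hf))
    (fun e he => (hreg e he).imp fun n hn => ⟨hn.1, by
      rw [MonoidHom.comp_apply, ← map_pow, hn.2, map_one]⟩)
    (fun a ha h => hB a ha fun e he => (hcomm a e).1 (h e he)) hAB

/-- Let `E` induce an abelian group of automorphisms of order prime to `p` on the elementary abelian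
`p`-group `W`, and let the abelian group `A` act nontrivially on that group. If `p` is odd, then
`|A : B| < |W : C_W(A)|`, where `B` contains the kernel of the latter action. -/
theorem relIndex_mul_card_fixed_lt {p : ℕ} [hp : Fact p.Prime] (hp2 : p ≠ 2)
    {X W : Type*} [Group X] [CommGroup W] [Finite W] (φ : X →* MulAut W) (E : Subgroup X) [E.Normal]
    (A B : Subgroup X) (hWp : ∀ x : W, x ^ p = 1) (hA : ∀ a ∈ A, ∀ b ∈ A, a * b = b * a)
    (hE : ∀ e ∈ E, ∀ f ∈ E, Commute (φ e) (φ f))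
    (hreg : ∀ e ∈ E, ∃ n : ℕ, n.Coprime p ∧ φ e ^ n = 1)
    (hB : ∀ a ∈ A, (∀ e ∈ E, Commute (φ a) (φ e)) → a ∈ B) (hAB : ¬ A ≤ B) :
    B.relIndex A * Nat.card {w : W // ∀ a ∈ A, φ a w = w} < Nat.card W := by
  let τ : MulAut W →* AddMonoid.End (Additive W) :=
    { toFun := fun f => f.toMonoidHom.toAdditive
      map_one' := rfl
      map_mul' := fun _ _ => rfl }
  have hτ : Function.Injective τ := fun f g h => MulEquiv.ext fun w =>
    congrArg Additive.toMul (DFunLike.congr_fun h (Additive.ofMul w))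
  have hcomm (x y : X) : Commute ((τ.comp φ) x) ((τ.comp φ) y) ↔ Commute (φ x) (φ y) :=
    ⟨fun h => hτ ((map_mul τ _ _).trans (h.eq.trans (map_mul τ _ _).symm)), fun h => h.map τ⟩
  have : Module (ZMod p) (Additive W) :=
    AddCommGroup.zmodModule fun x => congrArg Additive.ofMul (hWp x.toMul)
  exact index_mul_card_addInvariants_lt hp2 (τ.comp φ) E A B hA
    (fun e he f hf => (hcomm e f).2 (hE e he f hf))
    (fun e he => (hreg e he).imp fun n hn => ⟨hn.1, by
      rw [MonoidHom.comp_apply, ← map_pow, hn.2, map_one]⟩)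
    (fun a ha h => hB a ha fun e he => (hcomm a e).1 (h e he)) hAB

/-- Let `W` be a normal elementary abelian `p`-subgroup, let the normal subgroup `E` induce an abelian
group of order prime to `p` on `W`, and let the abelian group `A` act nontrivially on that group. If
`p` is odd, then `|A : B| < |W : C_W(A)|`, where `B` contains the kernel of the latter action. -/
theorem relIndex_mul_card_inf_centralizer_lt {p : ℕ} [hp : Fact p.Prime] (hp2 : p ≠ 2)
    {X : Type*} [Group X] [Finite X] (W E : Subgroup X) [hWn : W.Normal] [E.Normal]
    (A B : Subgroup X)
    (hW : ∀ x ∈ W, ∀ y ∈ W, x * y = y * x) (hWp : ∀ x ∈ W, x ^ p = 1)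
    (hA : ∀ a ∈ A, ∀ b ∈ A, a * b = b * a)
    (hE : ∀ e ∈ E, ∀ f ∈ E, ⁅e, f⁆ ∈ centralizer (W : Set X))
    (hreg : ∀ e ∈ E, ∃ n : ℕ, n.Coprime p ∧ e ^ n ∈ centralizer (W : Set X))
    (hB : ∀ a ∈ A, (∀ e ∈ E, ⁅a, e⁆ ∈ centralizer (W : Set X)) → a ∈ B) (hAB : ¬ A ≤ B) :
    B.relIndex A * Nat.card (W ⊓ centralizer (A : Set X) : Subgroup X) < Nat.card W := by
  have hφ (x : X) : MulAut.conjNormal (H := W) x = 1 ↔ x ∈ centralizer (W : Set X) := by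
    rw [mem_centralizer_iff]
    constructor
    · intro h w hw
      have h1 : x * w * x⁻¹ = w := by
        simpa using congrArg Subtype.val (MulEquiv.congr_fun h ⟨w, hw⟩)
      rw [mul_inv_eq_iff_eq_mul] at h1
      exact h1.symm
    · intro h
      refine MulEquiv.ext fun w => Subtype.ext ?_
      rw [MulAut.conjNormal_apply, ← h _ w.2, mul_inv_cancel_right]
      rfl
  have hcomm (x y : X) : Commute (MulAut.conjNormal (H := W) x) (MulAut.conjNormal (H := W) y) ↔
      ⁅x, y⁆ ∈ centralizer (W : Set X) := by
    rw [← hφ, map_commutatorElement, commutatorElement_eq_one_iff_commute]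
  let : CommGroup W :=
    { (inferInstance : Group W) with
      mul_comm := fun x y => Subtype.ext (hW x x.2 y y.2) }
  have key := relIndex_mul_card_fixed_lt hp2 (W := W) (MulAut.conjNormal (H := W)) E A B
    (fun x => Subtype.ext (hWp x x.2)) hA (fun e he f hf => (hcomm e f).2 (hE e he f hf))
    (fun e he => (hreg e he).imp fun n hn => ⟨hn.1, by rw [← map_pow]; exact (hφ _).2 hn.2⟩)
    (fun a ha h => hB a ha fun e he => (hcomm a e).1 (h e he)) hAB
  refine lt_of_eq_of_lt (congrArg _ (Nat.card_congr ?_)) key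
  have hfix (w : W) (a : X) : MulAut.conjNormal a w = w ↔ a * w = w * a := by
    rw [Subtype.ext_iff, MulAut.conjNormal_apply, mul_inv_eq_iff_eq_mul]
  exact
    { toFun := fun w => ⟨⟨w, w.2.1⟩, fun a ha => (hfix _ a).2 (mem_centralizer_iff.1 w.2.2 a ha)⟩
      invFun := fun w => ⟨w.1, w.1.2, mem_centralizer_iff.2 fun a ha => (hfix _ a).1 (w.2 a ha)⟩
      left_inv := fun w => rfl
      right_inv := fun w => rfl }

end ElementaryAbelian

/-! ### The Thompson subgroup -/

section ThompsonSubgroup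

open Subgroup

universe u

variable {X Y : Type*} [Group X] [Group Y]

/-- `A` is an abelian subgroup of `S` of maximal order. -/
structure IsMaxAbelian (S A : Subgroup X) : Prop where
  le : A ≤ S
  comm : ∀ x ∈ A, ∀ y ∈ A, x * y = y * x
  card_le : ∀ B ≤ S, (∀ x ∈ B, ∀ y ∈ B, x * y = y * x) → Nat.card B ≤ Nat.card A

/-- The subgroup generated by the abelian subgroups of `S` of maximal order. -/
def thompsonSubgroup (S : Subgroup X) : Subgroup X := sSup {A | IsMaxAbelian S A}

/-- The subgroup of the elements `x` of the center of `S` with `x ^ p = 1`. -/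
def omegaCenter (p : ℕ) (S : Subgroup X) : Subgroup X where
  carrier := {x | x ∈ S ∧ (∀ y ∈ S, x * y = y * x) ∧ x ^ p = 1}
  mul_mem' := by
    rintro a b ⟨ha, ha', hap⟩ ⟨hb, hb', hbp⟩
    refine ⟨mul_mem ha hb, fun y hy => ?_, ?_⟩
    · rw [mul_assoc, hb' y hy, ← mul_assoc, ha' y hy, mul_assoc]
    · rw [(show Commute a b from ha' b hb).mul_pow, hap, hbp, one_mul]
  one_mem' := ⟨one_mem _, fun y _ => by simp, one_pow p⟩
  inv_mem' := by
    rintro a ⟨ha, ha', hap⟩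
    exact ⟨inv_mem ha, fun y hy => (show Commute a y from ha' y hy).inv_left, by simp [hap]⟩

theorem mem_omegaCenter {p : ℕ} {S : Subgroup X} {x : X} :
    x ∈ omegaCenter p S ↔ x ∈ S ∧ (∀ y ∈ S, x * y = y * x) ∧ x ^ p = 1 := Iff.rfl

/-- A construction of a nontrivial characteristic subgroup in nontrivial `p`-groups, given as a map
on subgroups. -/
structure IsCharacteristicFunctor (p : ℕ)
    (K : ∀ {X : Type u} [Group X], Subgroup X → Subgroup X) : Prop where
  le : ∀ {X : Type u} [Group X] (S : Subgroup X), K S ≤ S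
  -- Injectivity is asked only on S, so this covers conjugations, inclusions and also quotients by
  -- p'-subgroups.
  map : ∀ {X Y : Type u} [Group X] [Group Y] (f : X →* Y) (S : Subgroup X),
    Set.InjOn f S → K (S.map f) = (K S).map f
  ne_bot : ∀ {X : Type u} [Group X] [Finite X] (S : Subgroup X),
    IsPGroup p S → S ≠ ⊥ → K S ≠ ⊥

theorem exists_isMaxAbelian [Finite X] (S : Subgroup X) : ∃ A, IsMaxAbelian S A := by
  obtain ⟨A, hA, hmax⟩ := Set.exists_max_image
    {A : Subgroup X | A ≤ S ∧ ∀ x ∈ A, ∀ y ∈ A, x * y = y * x} (fun A => Nat.card A)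
    (Set.toFinite _) ⟨⊥, bot_le, by simp⟩
  exact ⟨A, hA.1, hA.2, fun B hB hB' => hmax B ⟨hB, hB'⟩⟩

theorem thompsonSubgroup_le (S : Subgroup X) : thompsonSubgroup S ≤ S :=
  sSup_le fun _ hA => hA.le

theorem card_map_of_injOn {f : X →* Y} {S A : Subgroup X} (hf : Set.InjOn f S) (hA : A ≤ S) :
    Nat.card (A.map f) = Nat.card A :=
  Nat.card_image_of_injOn (hf.mono hA)

theorem map_inf_comap_of_le {f : X →* Y} {S : Subgroup X} {B : Subgroup Y} (hB : B ≤ S.map f) :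
    (S ⊓ B.comap f).map f = B := by
  refine le_antisymm ?_ fun y hy => ?_
  · rw [map_le_iff_le_comap]; exact inf_le_right
  · obtain ⟨x, hx, rfl⟩ := hB hy
    exact ⟨x, ⟨hx, hy⟩, rfl⟩

theorem comm_map_iff {f : X →* Y} {S A : Subgroup X} (hf : Set.InjOn f S) (hA : A ≤ S) :
    (∀ x ∈ A.map f, ∀ y ∈ A.map f, x * y = y * x) ↔ ∀ x ∈ A, ∀ y ∈ A, x * y = y * x := by
  constructor
  · intro h x hx y hy
    refine hf (mul_mem (hA hx) (hA hy)) (mul_mem (hA hy) (hA hx)) ?_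
    rw [map_mul, map_mul, h _ ⟨x, hx, rfl⟩ _ ⟨y, hy, rfl⟩]
  · rintro h _ ⟨x, hx, rfl⟩ _ ⟨y, hy, rfl⟩
    rw [← map_mul, h x hx y hy, map_mul]

theorem isMaxAbelian_map_iff {f : X →* Y} {S A : Subgroup X} (hf : Set.InjOn f S) (hA : A ≤ S) :
    IsMaxAbelian (S.map f) (A.map f) ↔ IsMaxAbelian S A := by
  constructor
  · intro h
    refine ⟨hA, (comm_map_iff hf hA).1 h.comm, fun B hB hB' => ?_⟩
    have := h.card_le _ (map_mono hB) ((comm_map_iff hf hB).2 hB')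
    rwa [card_map_of_injOn hf hB, card_map_of_injOn hf hA] at this
  · intro h
    refine ⟨map_mono hA, (comm_map_iff hf hA).2 h.comm, fun B hB hB' => ?_⟩
    have hle : S ⊓ B.comap f ≤ S := inf_le_left
    rw [← map_inf_comap_of_le hB] at hB' ⊢
    rw [card_map_of_injOn hf hle, card_map_of_injOn hf hA]
    exact h.card_le _ hle ((comm_map_iff hf hle).1 hB')

theorem thompsonSubgroup_map {f : X →* Y} {S : Subgroup X} (hf : Set.InjOn f S) :
    thompsonSubgroup (S.map f) = (thompsonSubgroup S).map f := by
  refine le_antisymm (sSup_le fun B hB => ?_) ?_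
  · have h1 := map_inf_comap_of_le hB.le
    rw [← h1] at hB ⊢
    exact map_mono (le_sSup ((isMaxAbelian_map_iff hf inf_le_left).1 hB))
  · rw [map_le_iff_le_comap]
    refine sSup_le fun A hA => ?_
    rw [← map_le_iff_le_comap]
    exact le_sSup ((isMaxAbelian_map_iff hf hA.le).2 hA)

theorem isCharacteristicFunctor_thompsonSubgroup (p : ℕ) :
    IsCharacteristicFunctor.{u} p thompsonSubgroup where
  le := thompsonSubgroup_le
  map := fun _ _ hf => thompsonSubgroup_map hf
  ne_bot := fun S _ hS h => by
    obtain ⟨⟨x, hx⟩, hx1⟩ := ne_bot_iff_exists_ne_one.1 hS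
    obtain ⟨A, hA⟩ := exists_isMaxAbelian S
    have h1 : A = ⊥ := le_bot_iff.1 (h ▸ le_sSup hA)
    have h2 := hA.card_le (zpowers x) (by rwa [zpowers_le]) (by
      rintro _ ⟨m, rfl⟩ _ ⟨n, rfl⟩
      simp only [← zpow_add, add_comm])
    rw [h1, card_bot] at h2
    have h3 := eq_bot_of_card_le _ h2
    rw [zpowers_eq_bot] at h3
    exact hx1 (Subtype.ext h3)

theorem isCharacteristicFunctor_omegaCenter (p : ℕ) [hp : Fact p.Prime] :
    IsCharacteristicFunctor.{u} p (omegaCenter p) where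
  le := fun S x hx => hx.1
  map := fun f S hf => by
    ext y
    constructor
    · rintro ⟨⟨x, hx, rfl⟩, h2, h3⟩
      refine ⟨x, ⟨hx, fun z hz => ?_, ?_⟩, rfl⟩
      · refine hf (mul_mem hx hz) (mul_mem hz hx) ?_
        rw [map_mul, map_mul, h2 _ ⟨z, hz, rfl⟩]
      · exact hf (pow_mem hx p) (one_mem S) (by rw [map_pow, h3, map_one])
    · rintro ⟨x, ⟨hx, h2, h3⟩, rfl⟩
      refine ⟨⟨x, hx, rfl⟩, ?_, by rw [← map_pow, h3, map_one]⟩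
      rintro _ ⟨z, hz, rfl⟩
      rw [← map_mul, h2 z hz, map_mul]
  ne_bot := fun S hS hne h => by
    have : Nontrivial S := (nontrivial_iff_ne_bot S).2 hne
    have h1 := hS.center_nontrivial
    have h2 : p ∣ Nat.card (center S) :=
      ((hS.to_subgroup _).card_eq_or_dvd).resolve_left (Finite.one_lt_card).ne'
    obtain ⟨z, hz⟩ := exists_prime_orderOf_dvd_card' p h2
    have hz1 : S.subtype z ∈ omegaCenter p S := by
      refine ⟨(z : S).2, fun y hy => ?_, ?_⟩
      · exact congrArg Subtype.val (mem_center_iff.1 z.2 ⟨y, hy⟩).symm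
      · have := pow_orderOf_eq_one z
        rw [hz] at this
        exact congrArg (fun w : center S => S.subtype w) this
    rw [h, mem_bot] at hz1
    have : z = 1 := Subtype.ext (Subtype.ext hz1)
    rw [this, orderOf_one] at hz
    exact hp.out.ne_one hz.symm

theorem IsCharacteristicFunctor.normalizer_le {p : ℕ}
    {K : ∀ {X : Type u} [Group X], Subgroup X → Subgroup X} (hK : IsCharacteristicFunctor p @K)
    {X : Type u} [Group X] (S : Subgroup X) :
    normalizer (S : Set X) ≤ normalizer (K S : Set X) := by
  intro g hg
  rw [mem_normalizer_iff_map_conj_eq] at hg ⊢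
  rw [← hK.map _ _ (MulAut.conj g).injective.injOn, hg]

end ThompsonSubgroup

/-! ### Inheritance of the local hypothesis -/

section Local

open Subgroup

universe u

/-- The normalizers of the subgroups `K S`, for `S` a Sylow `p`-subgroup, are `p`-nilpotent. -/
def SylowLocal (p : ℕ) (K : ∀ {X : Type u} [Group X], Subgroup X → Subgroup X) (X : Type u)
    [Group X] : Prop :=
  ∀ S : Sylow p X, PNilpotent p (normalizer (K (S : Subgroup X) : Set X))

variable {p : ℕ} {K : ∀ {X : Type u} [Group X], Subgroup X → Subgroup X} {X Y : Type u} [Group X]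
  [Group Y]

theorem SylowLocal.subgroup (hK : IsCharacteristicFunctor p @K) [Finite X] [hp : Fact p.Prime]
    (h : SylowLocal p @K X) {H : Subgroup X} (hH : ¬ p ∣ H.index) : SylowLocal p @K H := by
  intro T
  have h1 : ¬ p ∣ ((T : Subgroup H).map H.subtype).index := by
    rw [index_map_subtype, hp.out.dvd_mul, not_or]
    exact ⟨T.not_dvd_index, hH⟩
  have h2 := h ((T.isPGroup'.map H.subtype).toSylow h1)
  rw [IsPGroup.toSylow_coe, hK.map _ _ H.subtype_injective.injOn] at h2
  exact h2.normalizer_of_map H.subtype_injective _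

theorem injOn_of_isPGroup {f : X →* Y} {n : ℕ} (hn : n.Coprime p)
    (hf : ∀ x, f x = 1 → x ^ n = 1) {D : Subgroup X} (hD : IsPGroup p D) : Set.InjOn f D := by
  intro x hx y hy hxy
  have h1 : f (x * y⁻¹) = 1 := by rw [map_mul, map_inv, hxy, mul_inv_cancel]
  have h2 := (PRegular.of_pow hn (hf _ h1)).eq_one_of_mem hD (mul_mem hx (inv_mem hy))
  rwa [mul_inv_eq_one] at h2

theorem isPGroup_le_of_map_le {f : X →* Y} {n : ℕ} (hn : n.Coprime p)
    (hf : ∀ x, f x = 1 → x ^ n = 1) {D P : Subgroup X} (hP : IsPGroup p P) (hDP : D ≤ P)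
    (h : P.map f ≤ D.map f) : P ≤ D := by
  intro x hx
  obtain ⟨d, hd, hdx⟩ := h ⟨x, hx, rfl⟩
  rwa [← injOn_of_isPGroup hn hf hP (hDP hd) hx hdx]

theorem mem_normalizer_of_forall_conj_mem [Finite X] {D : Subgroup X} {x : X}
    (h : ∀ z ∈ D, x * z * x⁻¹ ∈ D) : x ∈ normalizer (D : Set X) := by
  rw [mem_normalizer_iff_map_conj_eq]
  refine eq_of_le_of_card_ge ?_
    (card_map_of_injOn (S := ⊤) (MulAut.conj x).injective.injOn le_top).ge
  rintro _ ⟨z, hz, rfl⟩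
  exact h z hz

/-- A Frattini argument: for a lift x, both D and its conjugate by x are Sylow in the preimage H of
the image of D, because f is injective on p-subgroups. So some h in H makes h * x normalize D, and h
has the same image as an element of D. -/
theorem normalizer_map_le_map_normalizer {f : X →* Y} [Finite X] [hp : Fact p.Prime]
    (hsurj : Function.Surjective f) {n : ℕ} (hn : n.Coprime p) (hf : ∀ x, f x = 1 → x ^ n = 1)
    {D : Subgroup X} (hD : IsPGroup p D) :
    normalizer (D.map f : Set Y) ≤ (normalizer (D : Set X)).map f := by
  intro y hy
  obtain ⟨x, rfl⟩ := hsurj y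
  set H := (D.map f).comap f with hH
  set D' := D.map (MulAut.conj x).toMonoidHom with hD'
  have hDH : D ≤ H := le_comap_map f D
  have hD'f : D'.map f = D.map f := by
    rw [mem_normalizer_iff_map_conj_eq] at hy
    conv_rhs => rw [← hy]
    rw [hD', map_map, map_map]
    congr 1
    ext z
    simp
  have hD'H : D' ≤ H := by rw [hH, ← hD'f]; exact le_comap_map f D'
  have hmax (C : Subgroup X) (hC : IsPGroup p C) (hCf : C.map f = D.map f) (Q : Subgroup H)
      (hQ : IsPGroup p Q) (hle : C.subgroupOf H ≤ Q) (hCH : C ≤ H) : Q = C.subgroupOf H := by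
    refine le_antisymm ?_ hle
    rw [← map_subtype_le_map_subtype, subgroupOf_map_subtype, inf_eq_left.2 hCH]
    refine isPGroup_le_of_map_le hn hf (hQ.map _) ?_ ?_
    · rw [← inf_eq_left.2 hCH, ← subgroupOf_map_subtype]
      exact map_mono hle
    · rw [hCf, map_le_iff_le_comap]
      exact map_subtype_le Q
  have hD'p : IsPGroup p D' := hD.map _
  let P : Sylow p H := ⟨D.subgroupOf H, hD.comap_subtype, fun hQ hle => hmax D hD rfl _ hQ hle hDH⟩
  let P' : Sylow p H :=
    ⟨D'.subgroupOf H, hD'p.comap_subtype, fun hQ hle => hmax D' hD'p hD'f _ hQ hle hD'H⟩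
  obtain ⟨h, hh⟩ := MulAction.exists_smul_eq H P' P
  obtain ⟨d, hd, hdh⟩ := h.2
  have hsm (z : X) (hz : z ∈ D) : (h * x) * z * (h * x : X)⁻¹ ∈ D := by
    have h1 : (⟨x * z * x⁻¹, hD'H ⟨z, hz, rfl⟩⟩ : H) ∈ P' := ⟨z, hz, rfl⟩
    have h2 : h * ⟨x * z * x⁻¹, hD'H ⟨z, hz, rfl⟩⟩ * h⁻¹ ∈ P := by
      rw [← hh]
      exact ⟨_, h1, rfl⟩
    have h3 : (h : X) * (x * z * x⁻¹) * (h : X)⁻¹ ∈ D := h2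
    simpa [mul_assoc] using h3
  have hN : (h : X) * x ∈ normalizer (D : Set X) := mem_normalizer_of_forall_conj_mem hsm
  refine ⟨d⁻¹ * (h * x), mul_mem (inv_mem (le_normalizer hd)) hN, ?_⟩
  rw [map_mul, map_mul, map_inv, hdh, inv_mul_cancel_left]

theorem SylowLocal.of_surjective (hK : IsCharacteristicFunctor p @K) [Finite X] [hp : Fact p.Prime]
    (h : SylowLocal p @K X) {f : X →* Y} (hsurj : Function.Surjective f) {n : ℕ} (hn : n.Coprime p)
    (hf : ∀ x, f x = 1 → x ^ n = 1) : SylowLocal p @K Y := by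
  intro T
  obtain ⟨S, rfl⟩ := Sylow.mapSurjective_surjective hsurj p T
  rw [Sylow.coe_mapSurjective, hK.map _ _ (injOn_of_isPGroup hn hf S.isPGroup')]
  exact ((h S).map hp.out f).mono
    (normalizer_map_le_map_normalizer hsurj hn hf (S.isPGroup'.to_le (hK.le _)))

/-- The preimage of the normalizer of `K T` has index prime to p. If it were all of X, the preimage
of `K T` would be a normal p-subgroup, hence inside U, and `K T` would be trivial. -/
theorem SylowLocal.quotient (hK : IsCharacteristicFunctor p @K) [Finite X] [hp : Fact p.Prime]
    (hsub : ∀ H : Subgroup X, H ≠ ⊤ → ¬ p ∣ H.index → PNilpotent p H)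
    (U : Subgroup X) [U.Normal] (hU : IsPGroup p U)
    (hmax : ∀ D : Subgroup X, D.Normal → IsPGroup p D → D ≤ U) : SylowLocal p @K (X ⧸ U) := by
  intro T
  by_cases hT : (T : Subgroup (X ⧸ U)) = ⊥
  · have h1 := T.not_dvd_index
    rw [hT, index_bot, ← card_top] at h1
    intro x y _ _
    exact pRegular_coe.1 (pRegular_of_not_dvd_card hp.out h1 (mem_top _))
  have hle : (T : Subgroup (X ⧸ U)) ≤ normalizer (K (T : Subgroup (X ⧸ U)) : Set (X ⧸ U)) :=
    le_normalizer.trans (hK.normalizer_le _)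
  have hs := QuotientGroup.mk'_surjective U
  have hker : (QuotientGroup.mk' U).ker = U := QuotientGroup.ker_mk' U
  set N := normalizer (K (T : Subgroup (X ⧸ U)) : Set (X ⧸ U)) with hN
  have h1 : PNilpotent p (N.comap (QuotientGroup.mk' U)) := by
    refine hsub _ (fun htop => ?_) ?_
    · have hNtop : N = ⊤ := by
        rw [← map_comap_eq_self_of_surjective hs N, htop, map_top_of_surjective _ hs]
      have hn : (K (T : Subgroup (X ⧸ U))).Normal := normalizer_eq_top_iff.1 hNtop
      have h2 := hmax ((K (T : Subgroup (X ⧸ U))).comap (QuotientGroup.mk' U)) (hn.comap _)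
        ((T.isPGroup'.to_le (hK.le _)).comap_of_ker_isPGroup _ (by rwa [hker]))
      refine hK.ne_bot _ T.isPGroup' hT ?_
      rw [← map_comap_eq_self_of_surjective hs (K (T : Subgroup (X ⧸ U))),
        Subgroup.map_eq_bot_iff, hker]
      exact h2
    · rw [index_comap_of_surjective _ hs]
      exact fun hd => T.not_dvd_index (hd.trans (index_dvd_of_le hle))
  have h2 := h1.map hp.out (QuotientGroup.mk' U)
  rwa [map_comap_eq_self_of_surjective hs] at h2

/-- The local hypothesis is inherited by the normalizer of `U` if its order has the largest `p`-part
among the normalizers that are not `p`-nilpotent. -/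
theorem SylowLocal.normalizer_of_max (hK : IsCharacteristicFunctor p @K) [Finite X]
    [hp : Fact p.Prime] (h : SylowLocal p @K X) {U : Subgroup X} (hU : IsPGroup p U) (hU1 : U ≠ ⊥)
    (hmax : ∀ V : Subgroup X, IsPGroup p V → V ≠ ⊥ → ¬ PNilpotent p (normalizer (V : Set X)) →
      (Nat.card (normalizer (V : Set X))).factorization p ≤
        (Nat.card (normalizer (U : Set X))).factorization p) :
    SylowLocal p @K (normalizer (U : Set X)) := by
  set N := normalizer (U : Set X) with hN
  intro T
  refine PNilpotent.normalizer_of_map N.subtype_injective _ ?_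
  rw [← hK.map _ _ N.subtype_injective.injOn]
  set D := (T : Subgroup N).map N.subtype with hD
  have hDp : IsPGroup p D := T.isPGroup'.map _
  obtain ⟨R, hR⟩ := hDp.exists_le_sylow
  rcases hR.eq_or_lt with heq | hlt
  · rw [heq]; exact h R
  by_contra hcon
  have hUD : U ≤ D := by
    have : (U.subgroupOf N).Normal := normal_in_normalizer
    have hUN : IsPGroup p (U.subgroupOf N) := hU.comap_subtype
    have h1 := hUN.le_sylow_of_normal T
    have h2 := map_mono (f := N.subtype) h1
    rwa [subgroupOf_map_subtype, inf_eq_left.2 le_normalizer] at h2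
  have hD1 : D ≠ ⊥ := fun h0 => hU1 (le_bot_iff.1 (h0 ▸ hUD))
  have h1 := hmax (K D) (hDp.to_le (hK.le _)) (hK.ne_bot _ hDp hD1) hcon
  -- Normalizers grow in R, so the normalizer of `K D` contains a p-subgroup larger than D, whose
  -- order is already the full p-part of |N|. This contradicts `h1`.
  have h2 := R.isPGroup'.lt_inf_normalizer hlt
  have hRp : IsPGroup p ((R : Subgroup X) ⊓ normalizer (D : Set X) : Subgroup X) :=
    R.isPGroup'.to_inf_left
  obtain ⟨a, ha⟩ := IsPGroup.iff_card.1 hRp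
  have h3 : p ^ a ∣ Nat.card (normalizer (K D : Set X)) := by
    rw [← ha]
    exact card_dvd_of_le (inf_le_right.trans (hK.normalizer_le D))
  have h4 : a ≤ (Nat.card (normalizer (K D : Set X))).factorization p :=
    (hp.out.pow_dvd_iff_le_factorization Nat.card_pos.ne').1 h3
  have h5 : Nat.card D = p ^ (Nat.card N).factorization p := by
    rw [hD, card_map_of_injOn (S := ⊤) N.subtype_injective.injOn le_top]
    exact T.card_eq_multiplicity
  have h6 : Nat.card D < p ^ a := by
    rw [← ha]
    exact Set.Finite.card_lt_card (Set.toFinite _) h2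
  rw [h5] at h6
  have h7 := (Nat.pow_lt_pow_iff_right hp.out.one_lt).1 h6
  omega

end Local

/-! ### Thompson's normal `p`-complement theorem -/

section Thompson

open Subgroup
open scoped commutatorElement

universe u

theorem card_inf_mul_relIndex {X : Type*} [Group X] (H K : Subgroup X) :
    Nat.card (H ⊓ K : Subgroup X) * H.relIndex K = Nat.card K := by
  have := relIndex_mul_relIndex ⊥ (H ⊓ K) K bot_le inf_le_right
  rwa [inf_relIndex_right, relIndex_bot_left, relIndex_bot_left] at this

theorem card_sup_mul_card_inf {X : Type*} [Group X] (H N : Subgroup X) [N.Normal] :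
    Nat.card (H ⊔ N : Subgroup X) * Nat.card (H ⊓ N : Subgroup X) = Nat.card H * Nat.card N := by
  have h1 := card_inf_mul_relIndex N (H ⊔ N)
  have h2 := card_inf_mul_relIndex N H
  rw [relIndex_sup_right, inf_eq_left.2 le_sup_right] at h1
  rw [inf_comm] at h2
  rw [← h1, ← h2]
  ring

theorem index_eq_relIndex_of_sup_eq_top {X : Type*} [Group X] [Finite X] {H N : Subgroup X}
    [N.Normal] (h : H ⊔ N = ⊤) : H.index = H.relIndex N := by
  have h1 := card_sup_mul_card_inf H N
  rw [h, card_top, ← card_mul_index H, ← card_inf_mul_relIndex H N] at h1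
  have hH : 0 < Nat.card H := Nat.card_pos
  have hHN : 0 < Nat.card (H ⊓ N : Subgroup X) := Nat.card_pos
  refine Nat.eq_of_mul_eq_mul_left (Nat.mul_pos hH hHN) ?_
  linarith

/-- A group in which a central `p`-subgroup has index prime to `p` is `p`-nilpotent. -/
theorem PNilpotent.of_le_center {p : ℕ} [hp : Fact p.Prime] {X : Type*} [Group X] [Finite X]
    {Z : Subgroup X} (hZ : IsPGroup p Z) (hc : Z ≤ center X) (hi : ¬ p ∣ Z.index) :
    PNilpotent p X := by
  have hn : Z.Normal := ⟨fun z hz g => by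
    rwa [mem_center_iff.1 (hc hz) g, mul_inv_cancel_right]⟩
  obtain ⟨k, hk⟩ := IsPGroup.iff_card.1 hZ
  have hcop : p.Coprime Z.index := (Nat.Prime.coprime_iff_not_dvd hp.out).2 hi
  -- By Schur–Zassenhaus Z has a complement H. As Z is central, a p-regular z * h has z = 1, so all
  -- p-regular elements lie in the p'-group H.
  obtain ⟨H, hH⟩ := exists_right_complement'_of_coprime (N := Z) (by
    rw [hk]; exact hcop.pow_left k)
  have hcard : Nat.card H = Z.index := (IsComplement'.index_eq_card hH.symm).symm
  have hmem (x : X) (hx : PRegular p x) : x ∈ H := by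
    obtain ⟨⟨z, h⟩, rfl⟩ := hH.2 x
    have hcomm : Commute (z : X) h := (mem_center_iff.1 (hc z.2) h).symm
    have h1 : ((z : X) * h) ^ Nat.card H = (z : X) ^ Nat.card H := by
      rw [hcomm.mul_pow]
      have : (h : X) ^ Nat.card H = 1 := by
        exact_mod_cast congrArg Subtype.val (pow_card_eq_one' (x := h))
      rw [this, mul_one]
    have hz : (z : X) ^ (Nat.card H * orderOf ((z : X) * h)) = 1 := by
      rw [pow_mul, ← h1, ← pow_mul, mul_comm, pow_mul, pow_orderOf_eq_one, one_pow]
    have hz1 : (z : X) = 1 := by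
      refine PRegular.eq_one_of_mem (PRegular.of_pow ?_ hz) hZ z.2
      exact Nat.Coprime.mul_left (by rw [hcard]; exact hcop.symm) hx
    change (z : X) * h ∈ H
    rw [hz1, one_mul]
    exact h.2
  intro x y hx hy
  exact pRegular_of_not_dvd_card hp.out (by rwa [hcard]) (mul_mem (hmem x hx) (hmem y hy))

/-- The properties of a minimal counterexample to Thompson's theorem, with `U` its largest normal
`p`-subgroup. -/
structure IsCritical (p : ℕ) {X : Type*} [Group X] (U : Subgroup X) : Prop where
  normal : U.Normal
  isPGroup : IsPGroup p U
  le : ∀ D : Subgroup X, D.Normal → IsPGroup p D → D ≤ U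
  subgroup : ∀ H : Subgroup X, H ≠ ⊤ → ¬ p ∣ H.index → PNilpotent p H
  eq_bot : ∀ N : Subgroup X, N.Normal → ¬ p ∣ Nat.card N → N = ⊥
  not_pNilpotent : ¬ PNilpotent p X
  quotient : PNilpotent p (X ⧸ U)

namespace IsCritical

variable {p : ℕ} {X : Type*} [Group X] {U : Subgroup X}

/-- The preimage of the normal `p`-complement of `X ⧸ U`. -/
def kernel (h : IsCritical p U) : Subgroup X :=
  have := h.normal
  h.quotient.complement.comap (QuotientGroup.mk' U)

theorem mem_kernel (h : IsCritical p U) {x : X} :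
    x ∈ h.kernel ↔ ∃ n : ℕ, n.Coprime p ∧ x ^ n ∈ U := by
  have := h.normal
  change PRegular p (QuotientGroup.mk' U x) ↔ _
  constructor
  · intro hx
    refine ⟨_, hx, ?_⟩
    have h1 := pow_orderOf_eq_one (QuotientGroup.mk' U x)
    rw [← map_pow] at h1
    exact (QuotientGroup.eq_one_iff _).1 h1
  · rintro ⟨n, hn, hx⟩
    refine PRegular.of_pow hn ?_
    rw [← map_pow]
    exact (QuotientGroup.eq_one_iff _).2 hx

theorem kernel_normal (h : IsCritical p U) : h.kernel.Normal :=
  have := h.normal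
  h.quotient.complement_normal.comap _

theorem not_isPGroup (h : IsCritical p U) : ¬ IsPGroup p X := fun hX =>
  h.not_pNilpotent fun x y hx hy => by
    have hT : IsPGroup p (⊤ : Subgroup X) := hX.to_subgroup _
    rw [hx.eq_one_of_mem hT (mem_top x), hy.eq_one_of_mem hT (mem_top y), one_mul]
    exact pRegular_one

variable [hp : Fact p.Prime] [Finite X]

/-- Every element has a p-power power in the kernel, so D is a p-group as soon as its part in the
kernel is. -/
theorem le_of_inf_kernel_le (h : IsCritical p U) {D : Subgroup X} (hD : D.Normal)
    (hDU : D ⊓ h.kernel ≤ U) : D ≤ U := by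
  refine h.le D hD (isPGroup_iff_pow_pow_eq_one.2 ?_)
  rintro ⟨x, hx⟩
  obtain ⟨a, m, hm, h1⟩ := exists_pow_pRegular hp.out x
  have h2 : x ^ p ^ a ∈ U :=
    hDU ⟨pow_mem hx _, h.mem_kernel.2 ⟨m, hm, by rw [h1]; exact one_mem U⟩⟩
  obtain ⟨b, hb⟩ := isPGroup_iff_pow_pow_eq_one.1 h.isPGroup ⟨_, h2⟩
  refine ⟨a + b, Subtype.ext ?_⟩
  have hb' : (x ^ p ^ a) ^ p ^ b = 1 := congrArg Subtype.val hb
  rw [pow_add, pow_mul]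
  exact hb'

/-- In the part C of the centralizer inside the kernel, U ∩ C is central of index prime to p, so C
is p-nilpotent. Its p-complement is normal in X, hence trivial, and C is a normal p-subgroup. -/
theorem centralizer_le (h : IsCritical p U) : centralizer (U : Set X) ≤ U := by
  have := h.normal
  have := h.kernel_normal
  refine h.le_of_inf_kernel_le inferInstance ?_
  set C := centralizer (U : Set X) ⊓ h.kernel with hC
  have hCn : C.Normal := inferInstance
  have hCnil : PNilpotent p C := by
    refine PNilpotent.of_le_center (Z := U.subgroupOf C) h.isPGroup.comap_subtype ?_ ?_
    · intro z hz
      rw [mem_center_iff]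
      intro c
      exact Subtype.ext (mem_centralizer_iff.1 c.2.1 z hz).symm
    · intro hd
      have : (U.subgroupOf C).Normal := inferInstance
      rw [index_eq_card] at hd
      obtain ⟨x, hx⟩ := exists_prime_orderOf_dvd_card' p hd
      obtain ⟨c, rfl⟩ := QuotientGroup.mk_surjective x
      obtain ⟨n, hn, hcn⟩ := h.mem_kernel.1 c.2.2
      have h1 : orderOf (c : C ⧸ U.subgroupOf C) ∣ n := by
        refine orderOf_dvd_of_pow_eq_one ?_
        rw [← QuotientGroup.mk_pow, QuotientGroup.eq_one_iff]
        exact hcn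
      rw [hx] at h1
      exact hp.out.one_lt.ne' (Nat.dvd_one.1 (hn ▸ Nat.dvd_gcd h1 dvd_rfl))
  have hmem (x : X) : x ∈ hCnil.complement.map C.subtype ↔ x ∈ C ∧ PRegular p x := by
    constructor
    · rintro ⟨c, hc, rfl⟩
      exact ⟨c.2, pRegular_coe.2 hc⟩
    · rintro ⟨hx, hx'⟩
      exact ⟨⟨x, hx⟩, pRegular_coe.1 hx', rfl⟩
  have hbot := h.eq_bot (hCnil.complement.map C.subtype)
    ⟨fun x hx g => by
      rw [hmem] at hx ⊢
      exact ⟨hCn.conj_mem x hx.1 g, hx.2.conj g⟩⟩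
    (not_dvd_card_of_pRegular hp.out fun x hx => ((hmem x).1 hx).2)
  refine h.le C hCn (isPGroup_of_pRegular_eq_one hp.out fun x hx hx' => ?_)
  have := (hmem x).2 ⟨hx, hx'⟩
  rwa [hbot, mem_bot] at this

theorem le_of_not_dvd_index (h : IsCritical p U) {H : Subgroup X} (hH : ¬ p ∣ H.index) : U ≤ H := by
  have := h.normal
  obtain ⟨T⟩ : Nonempty (Sylow p H) := inferInstance
  have h1 : ¬ p ∣ ((T : Subgroup H).map H.subtype).index := by
    rw [index_map_subtype, hp.out.dvd_mul, not_or]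
    exact ⟨T.not_dvd_index, hH⟩
  exact (h.isPGroup.le_sylow_of_normal ((T.isPGroup'.map H.subtype).toSylow h1)).trans
    (map_subtype_le _)

/-- H is p-nilpotent and contains U, so its p-regular elements centralize U, hence lie in U and are
trivial. -/
theorem isPGroup_of_not_dvd_index (h : IsCritical p U) {H : Subgroup X} (hH : H ≠ ⊤)
    (hi : ¬ p ∣ H.index) : IsPGroup p H := by
  have hn := h.subgroup H hH hi
  have hUH := h.le_of_not_dvd_index hi
  refine isPGroup_of_pRegular_eq_one hp.out fun y hy hy' => ?_
  refine hy'.eq_one_of_mem h.isPGroup (h.centralizer_le (mem_centralizer_iff.2 fun u hu => ?_))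
  have h1 : y * (u * y⁻¹ * u⁻¹) = 1 := by
    have hu' := hUH hu
    refine PRegular.eq_one_of_mem (hn.pRegular_mul hy
      (mul_mem (mul_mem hu' (inv_mem hy)) (inv_mem hu')) hy' (hy'.inv.conj u)) h.isPGroup ?_
    simpa [mul_assoc] using mul_mem (h.normal.conj_mem u hu y) (inv_mem hu)
  rw [← mul_assoc, ← mul_assoc, mul_inv_eq_one, mul_inv_eq_iff_eq_mul] at h1
  exact h1.symm

theorem sylow_sup_eq_top (h : IsCritical p U) (S : Sylow p X) {D : Subgroup X}
    (hD : ¬ IsPGroup p D) : (S : Subgroup X) ⊔ D = ⊤ := by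
  by_contra hne
  refine hD ((h.isPGroup_of_not_dvd_index hne fun hd => ?_).to_le le_sup_right)
  exact S.not_dvd_index (hd.trans (index_dvd_of_le le_sup_left))

/-- There is a normal subgroup `E` such that `E / U` is a nontrivial abelian group of order prime
to `p`. -/
theorem exists_normal_abelian (h : IsCritical p U) :
    ∃ E : Subgroup X, E.Normal ∧ ¬ IsPGroup p E ∧ (∀ e ∈ E, ∀ f ∈ E, ⁅e, f⁆ ∈ U) ∧
      ∀ e ∈ E, ∃ n : ℕ, n.Coprime p ∧ e ^ n ∈ U := by
  have := h.normal
  have hs := QuotientGroup.mk'_surjective U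
  have hker : (QuotientGroup.mk' U).ker = U := QuotientGroup.ker_mk' U
  set L := h.quotient.complement with hL
  have hLp : ¬ p ∣ Nat.card L := h.quotient.not_dvd_card_complement hp.out
  have hcomap (D : Subgroup (X ⧸ U)) (hD : IsPGroup p (D.comap (QuotientGroup.mk' U))) :
      IsPGroup p D := by
    have := hD.map (QuotientGroup.mk' U)
    rwa [map_comap_eq_self_of_surjective hs] at this
  have hLne : Nat.card L ≠ 1 := by
    intro hc
    have hbot : L = ⊥ := card_eq_one.1 hc
    have hX : IsPGroup p (⊤ : Subgroup (X ⧸ U)) :=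
      isPGroup_of_pRegular_eq_one hp.out fun x _ hx => by
        have : x ∈ L := hx
        rwa [hbot, mem_bot] at this
    have h2 := hX.comap_of_ker_isPGroup (QuotientGroup.mk' U) (by rw [hker]; exact h.isPGroup)
    rw [comap_top] at h2
    exact h.not_isPGroup (h2.of_equiv topEquiv)
  obtain ⟨q, hq, hqL⟩ := Nat.exists_prime_and_dvd hLne
  have := Fact.mk hq
  have hqp : q ≠ p := fun he => hLp (he ▸ hqL)
  obtain ⟨Q⟩ : Nonempty (Sylow q L) := inferInstance
  set Q' := (Q : Subgroup L).map L.subtype with hQ'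
  have hQ'q : IsPGroup q Q' := Q.isPGroup'.map _
  have hQ'1 : Q' ≠ ⊥ := by
    rw [hQ', Ne, map_eq_bot_iff_of_injective _ L.subtype_injective]
    exact Q.ne_bot_of_dvd_card hqL
  have hnotp (D : Subgroup (X ⧸ U)) (hDq : IsPGroup q D) (hD : D ≠ ⊥) :
      ¬ IsPGroup p (D.comap (QuotientGroup.mk' U)) := fun hc =>
    hD (disjoint_self.1 (IsPGroup.disjoint_of_ne q p hqp D D hDq (hcomap D hc)))
  -- By Frattini the index of the normalizer divides |L|, so is prime to p; were it proper, its
  -- preimage would be a p-group, though Q' is a nontrivial q-group. Thus Q' is normal, and E is the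
  -- preimage of its center.
  have hfr : normalizer (Q' : Set (X ⧸ U)) ⊔ L = ⊤ := Sylow.normalizer_sup_eq_top Q
  have hidx : ¬ p ∣ (normalizer (Q' : Set (X ⧸ U))).index := by
    intro hd
    refine hLp (hd.trans ?_)
    rw [index_eq_relIndex_of_sup_eq_top hfr]
    exact relIndex_dvd_card _ _
  have hQn : Q'.Normal := by
    rw [← normalizer_eq_top_iff]
    by_contra hne
    refine hnotp Q' hQ'q hQ'1 ((h.isPGroup_of_not_dvd_index (H := (normalizer
      (Q' : Set (X ⧸ U))).comap (QuotientGroup.mk' U)) (fun ht => hne ?_) ?_).to_le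
      (comap_mono le_normalizer))
    · rw [← map_comap_eq_self_of_surjective hs (normalizer _), ht, map_top_of_surjective _ hs]
    · rwa [index_comap_of_surjective _ hs]
  have hE1 : Q' ⊓ centralizer (Q' : Set (X ⧸ U)) ≠ ⊥ := by
    have : Nontrivial Q' := (nontrivial_iff_ne_bot _).2 hQ'1
    have := hQ'q.center_nontrivial
    obtain ⟨z, hz⟩ := exists_ne (1 : center Q')
    intro hbot
    have hz' : ((z : Q') : X ⧸ U) ∈ Q' ⊓ centralizer (Q' : Set (X ⧸ U)) :=
      ⟨(z : Q').2, mem_centralizer_iff.2 fun y hy =>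
        congrArg Subtype.val (mem_center_iff.1 z.2 ⟨y, hy⟩)⟩
    rw [hbot, mem_bot] at hz'
    exact hz (Subtype.ext (Subtype.ext hz'))
  refine ⟨(Q' ⊓ centralizer (Q' : Set (X ⧸ U))).comap (QuotientGroup.mk' U),
    Normal.comap inferInstance _, hnotp _ hQ'q.to_inf_left hE1, fun e he f hf => ?_,
    fun e he => ?_⟩
  · rw [← QuotientGroup.eq_one_iff]
    change QuotientGroup.mk' U ⁅e, f⁆ = 1
    rw [map_commutatorElement, commutatorElement_eq_one_iff_mul_comm]
    exact mem_centralizer_iff.1 hf.2 _ he.1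
  · obtain ⟨k, hk⟩ := isPGroup_iff_pow_pow_eq_one.1 hQ'q ⟨_, he.1⟩
    refine ⟨q ^ k, ((Nat.coprime_primes hq hp.out).2 hqp).pow_left k, ?_⟩
    rw [← QuotientGroup.eq_one_iff]
    change QuotientGroup.mk' U (e ^ q ^ k) = 1
    rw [map_pow]
    exact congrArg Subtype.val hk

end IsCritical

end Thompson

/-! ### Maximal abelian subgroups in a minimal counterexample -/

section Thompson

open Subgroup
open scoped commutatorElement

universe u

theorem pNilpotent_of_normalizer_eq_top {p : ℕ} {X : Type*} [Group X] {D : Subgroup X}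
    (h : PNilpotent p (normalizer (D : Set X))) (ht : normalizer (D : Set X) = ⊤) :
    PNilpotent p X := by
  rw [ht] at h
  exact PNilpotent.of_injective (f := (topEquiv (G := X)).symm.toMonoidHom)
    topEquiv.symm.injective h

namespace IsCritical

variable {p : ℕ} {X : Type u} [Group X] {U : Subgroup X}

theorem le_centralizer_omegaCenter : U ≤ centralizer (omegaCenter p U : Set X) := fun u hu =>
  mem_centralizer_iff.2 fun _ hw => hw.2.1 u hu

variable [hp : Fact p.Prime]

theorem omegaCenter_normal (h : IsCritical p U) : (omegaCenter p U).Normal := by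
  have := h.normal
  rw [← normalizer_eq_top_iff, ← top_le_iff, ← normalizer_eq_top U]
  exact (isCharacteristicFunctor_omegaCenter p).normalizer_le U

variable [Finite X]

theorem omegaCenter_sylow_le (h : IsCritical p U) (S : Sylow p X) :
    omegaCenter p (S : Subgroup X) ≤ omegaCenter p U := by
  have := h.normal
  have hUS : U ≤ S := h.isPGroup.le_sylow_of_normal S
  intro x hx
  rw [mem_omegaCenter] at hx ⊢
  refine ⟨h.centralizer_le (mem_centralizer_iff.2 fun u hu => (hx.2.1 u (hUS hu)).symm),
    fun u hu => hx.2.1 u (hUS hu), hx.2.2⟩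

/-- If the part of this centralizer in the kernel were not a p-group, it would generate X together
with S. Both normalize Ω₁(Z(S)) ≤ Ω₁(Z(U)), so X would be p-nilpotent by `hZ`. -/
theorem centralizer_omegaCenter_le (h : IsCritical p U) (hZ : SylowLocal p (omegaCenter p) X) :
    centralizer (omegaCenter p U : Set X) ≤ U := by
  have := h.omegaCenter_normal
  have := h.kernel_normal
  refine h.le_of_inf_kernel_le inferInstance (h.le _ inferInstance ?_)
  obtain ⟨S⟩ : Nonempty (Sylow p X) := inferInstance
  by_contra hcon
  refine h.not_pNilpotent (pNilpotent_of_normalizer_eq_top (hZ S) ?_)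
  rw [← top_le_iff, ← h.sylow_sup_eq_top S hcon]
  refine sup_le (le_normalizer.trans
    ((isCharacteristicFunctor_omegaCenter p).normalizer_le _)) fun x hx => ?_
  refine mem_normalizer_iff_map_conj_eq.2 ?_
  have hfix (z : X) (hz : z ∈ omegaCenter p (S : Subgroup X)) : x * z * x⁻¹ = z := by
    rw [← mem_centralizer_iff.1 hx.1 z (h.omegaCenter_sylow_le S hz), mul_inv_cancel_right]
  ext z
  constructor
  · rintro ⟨y, hy, rfl⟩
    change x * y * x⁻¹ ∈ _
    rwa [hfix y hy]
  · intro hz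
    exact ⟨z, hz, hfix z hz⟩

/-- Every abelian subgroup of maximal order of a Sylow subgroup lies in `U`. -/
theorem isMaxAbelian_le (h : IsCritical p U) (hp2 : p ≠ 2) (hZ : SylowLocal p (omegaCenter p) X)
    (S : Sylow p X) {A : Subgroup X} (hA : IsMaxAbelian (S : Subgroup X) A) : A ≤ U := by
  have := h.normal
  have hWn := h.omegaCenter_normal
  have hUS : U ≤ S := h.isPGroup.le_sylow_of_normal S
  obtain ⟨E, hEn, hEp, hEab, hEreg⟩ := h.exists_normal_abelian
  have hUC : U ≤ centralizer (omegaCenter p U : Set X) := le_centralizer_omegaCenter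
  have hCU := h.centralizer_omegaCenter_le hZ
  set W := omegaCenter p U with hW
  have hWU : W ≤ U := fun x hx => hx.1
  have hWc (x : X) (hx : x ∈ W) (y : X) (hy : y ∈ W) : x * y = y * x := hx.2.1 y (hWU hy)
  -- F is the kernel of the action on E/U. S ∩ F is normalized by S and by E, which generate X, so
  -- it lies in U.
  let F : Subgroup X := (centralizer (E.map (QuotientGroup.mk' U) : Set (X ⧸ U))).comap
    (QuotientGroup.mk' U)
  have hEm : (E.map (QuotientGroup.mk' U)).Normal := hEn.map _ (QuotientGroup.mk'_surjective U)
  have hFn : F.Normal := Normal.comap inferInstance _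
  have hF (x : X) : x ∈ F ↔ ∀ e ∈ E, ⁅x, e⁆ ∈ U := by
    have h1 (e : X) : ⁅x, e⁆ ∈ U ↔ QuotientGroup.mk' U e * QuotientGroup.mk' U x =
        QuotientGroup.mk' U x * QuotientGroup.mk' U e := by
      rw [← QuotientGroup.eq_one_iff]
      change QuotientGroup.mk' U ⁅x, e⁆ = 1 ↔ _
      rw [map_commutatorElement, commutatorElement_eq_one_iff_mul_comm, eq_comm]
    constructor
    · intro hx e he
      exact (h1 e).2 (mem_centralizer_iff.1 hx _ ⟨e, he, rfl⟩)
    · intro hx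
      refine mem_centralizer_iff.2 ?_
      rintro _ ⟨e, he, rfl⟩
      exact (h1 e).1 (hx e he)
  have hSF : (S : Subgroup X) ⊓ F ≤ U := by
    refine h.le _ ?_ S.isPGroup'.to_inf_left
    rw [← normalizer_eq_top_iff, ← top_le_iff, ← h.sylow_sup_eq_top S hEp]
    refine sup_le (fun s hs => ?_) fun e he => ?_
    · exact mem_normalizer_of_forall_conj_mem fun z hz =>
        ⟨(S : Subgroup X).mul_mem (mul_mem hs hz.1) (inv_mem hs), hFn.conj_mem z hz.2 s⟩
    · refine mem_normalizer_of_forall_conj_mem fun z hz => ⟨?_, hFn.conj_mem z hz.2 e⟩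
      have h1 : e * z * e⁻¹ = ⁅z, e⁆⁻¹ * z := by rw [commutatorElement_def]; group
      change e * z * e⁻¹ ∈ (S : Subgroup X)
      rw [h1]
      exact mul_mem (inv_mem (hUS ((hF z).1 hz.2 e he))) hz.1
  by_contra hAU
  have key := relIndex_mul_card_inf_centralizer_lt hp2 W E A U hWc (fun x hx => hx.2.2) hA.comm
    (fun e he f hf => hUC (hEab e he f hf))
    (fun e he => (hEreg e he).imp fun n hn => ⟨hn.1, hUC hn.2⟩)
    -- Commuting with the action of E on W means centralizing E/U, since C(W) ≤ U.
    (fun a ha hae => hSF ⟨hA.le ha, (hF a).2 fun e he => hCU (hae e he)⟩) hAU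
  have hcard := card_sup_mul_card_inf (U ⊓ A) W
  have h1 : Nat.card ((U ⊓ A) ⊔ W : Subgroup X) ≤ Nat.card A := by
    refine hA.card_le _ (sup_le (inf_le_right.trans hA.le) (hWU.trans hUS)) ?_
    intro x hx y hy
    obtain ⟨a, ha, w, hw, rfl⟩ := mem_sup_of_normal_right.1 hx
    obtain ⟨b, hb, v, hv, rfl⟩ := mem_sup_of_normal_right.1 hy
    have e1 := hA.comm a ha.2 b hb.2
    have e2 : w * b = b * w := hw.2.1 b hb.1
    have e3 : v * a = a * v := hv.2.1 a ha.1
    have e4 := hWc w hw v hv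
    calc a * w * (b * v) = a * (w * b) * v := by group
      _ = (a * b) * (w * v) := by rw [e2]; group
      _ = b * (a * v) * w := by rw [e1, e4]; group
      _ = b * v * (a * w) := by rw [← e3]; group
  have h2 : Nat.card ((U ⊓ A) ⊓ W : Subgroup X) ≤
      Nat.card (W ⊓ centralizer (A : Set X) : Subgroup X) := by
    refine card_le_of_le (le_inf inf_le_right fun x hx => ?_)
    exact mem_centralizer_iff.2 fun a ha => hA.comm a ha x hx.1.2
  have h3 := card_inf_mul_relIndex U A
  have hpos : 0 < Nat.card (U ⊓ A : Subgroup X) := Nat.card_pos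
  have h4 : Nat.card (U ⊓ A : Subgroup X) * Nat.card W ≤ Nat.card (U ⊓ A : Subgroup X) *
      (U.relIndex A * Nat.card (W ⊓ centralizer (A : Set X) : Subgroup X)) := by
    rw [← hcard, ← mul_assoc, h3]
    exact Nat.mul_le_mul h1 h2
  exact absurd (Nat.le_of_mul_le_mul_left h4 hpos) (by omega)

theorem false_of_sylowLocal (h : IsCritical p U) (hp2 : p ≠ 2)
    (hZ : SylowLocal p (omegaCenter p) X) (hJ : SylowLocal p thompsonSubgroup X) : False := by
  have := h.normal
  obtain ⟨S⟩ : Nonempty (Sylow p X) := inferInstance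
  have hUS : U ≤ S := h.isPGroup.le_sylow_of_normal S
  obtain ⟨A₀, hA₀⟩ := exists_isMaxAbelian (S : Subgroup X)
  have hmax (A : Subgroup X) : IsMaxAbelian (S : Subgroup X) A ↔ IsMaxAbelian U A := by
    constructor
    · intro hA
      exact ⟨h.isMaxAbelian_le hp2 hZ S hA, hA.comm, fun B hB => hA.card_le B (hB.trans hUS)⟩
    · intro hA
      refine ⟨hA.le.trans hUS, hA.comm, fun B hB hB' => (hA₀.card_le B hB hB').trans ?_⟩
      exact hA.card_le A₀ (h.isMaxAbelian_le hp2 hZ S hA₀) hA₀.comm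
  have heq : thompsonSubgroup (S : Subgroup X) = thompsonSubgroup U :=
    congrArg sSup (Set.ext hmax)
  refine h.not_pNilpotent (pNilpotent_of_normalizer_eq_top (hJ S) ?_)
  change normalizer (thompsonSubgroup (S : Subgroup X) : Set X) = ⊤
  rw [heq, ← top_le_iff, ← normalizer_eq_top U]
  exact (isCharacteristicFunctor_thompsonSubgroup p).normalizer_le U

end IsCritical

theorem exists_max_normal_isPGroup (p : ℕ) {X : Type*} [Group X] [Finite X] :
    ∃ U : Subgroup X, U.Normal ∧ IsPGroup p U ∧ ∀ D : Subgroup X, D.Normal → IsPGroup p D → D ≤ U :=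
  ⟨sSup {D | D.Normal ∧ IsPGroup p D}, sSup_normal _ fun _ h => h.1,
    Sylow.sSup_of_normal _ (fun _ h => h.2) (fun _ h => h.1),
    fun _ h1 h2 => le_sSup ⟨h1, h2⟩⟩

/-- **Thompson's normal `p`-complement theorem** for odd `p`. -/
theorem pNilpotent_of_sylowLocal {p : ℕ} [hp : Fact p.Prime] (hp2 : p ≠ 2) {X : Type u} [Group X]
    [Finite X] (hZ : SylowLocal p (omegaCenter p) X) (hJ : SylowLocal p thompsonSubgroup X) :
    PNilpotent p X := by
  induction hn : Nat.card X using Nat.strong_induction_on generalizing X with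
  | _ n ih =>
  have fZ := isCharacteristicFunctor_omegaCenter.{u} p
  have fJ := isCharacteristicFunctor_thompsonSubgroup.{u} p
  by_contra hX
  have hlt (H : Subgroup X) (hH : H ≠ ⊤) : Nat.card H < n := by
    rw [← hn]
    exact lt_of_le_of_ne (card_le_card_group _) fun he => hH (eq_top_of_card_eq _ he)
  have hqlt (N : Subgroup X) (hN : N ≠ ⊥) : Nat.card (X ⧸ N) < n := by
    rw [← hn, ← index_eq_card, ← card_mul_index N]
    have h1 : 1 < Nat.card N := by
      rw [one_lt_card_iff_ne_bot]
      exact hN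
    have h2 : 0 < N.index := Nat.pos_of_ne_zero FiniteIndex.index_ne_zero
    nlinarith
  have hsub (H : Subgroup X) (hH : H ≠ ⊤) (hi : ¬ p ∣ H.index) : PNilpotent p H :=
    ih _ (hlt H hH) (hZ.subgroup fZ hi) (hJ.subgroup fJ hi) rfl
  obtain ⟨U, hUn, hUp, hUmax⟩ := exists_max_normal_isPGroup p (X := X)
  -- Frobenius' criterion supplies a bad normalizer; one with the largest p-part inherits the
  -- hypotheses, so by induction it is all of X.
  have hU1 : U ≠ ⊥ := by
    have hne : ∃ V : Subgroup X, IsPGroup p V ∧ V ≠ ⊥ ∧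
        ¬ PNilpotent p (normalizer (V : Set X)) := by
      by_contra! hcon
      exact hX (pNilpotent_of_normalizer hcon)
    obtain ⟨V, ⟨hVp, hV1, hV⟩, hVmax⟩ := Set.exists_max_image
      {V : Subgroup X | IsPGroup p V ∧ V ≠ ⊥ ∧ ¬ PNilpotent p (normalizer (V : Set X))}
      (fun V => (Nat.card (normalizer (V : Set X))).factorization p) (Set.toFinite _) hne
    have hVmax' (D : Subgroup X) (h1 : IsPGroup p D) (h2 : D ≠ ⊥)
        (h3 : ¬ PNilpotent p (normalizer (D : Set X))) := hVmax D ⟨h1, h2, h3⟩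
    have htop : normalizer (V : Set X) = ⊤ := by
      by_contra hcon
      exact hV (ih _ (hlt _ hcon) (hZ.normalizer_of_max fZ hVp hV1 hVmax')
        (hJ.normalizer_of_max fJ hVp hV1 hVmax') rfl)
    exact fun h0 => hV1 (le_bot_iff.1 (h0 ▸ hUmax V (normalizer_eq_top_iff.1 htop) hVp))
  have hcrit : IsCritical p U :=
    { normal := hUn
      isPGroup := hUp
      le := hUmax
      subgroup := hsub
      eq_bot := fun N hN hNp => by
        by_contra hN1
        have hc : (Nat.card N).Coprime p := ((Nat.Prime.coprime_iff_not_dvd hp.out).2 hNp).symm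
        have hk (x : X) (hx : QuotientGroup.mk' N x = 1) : x ^ Nat.card N = 1 := by
          have := pow_card_eq_one' (x := (⟨x, (QuotientGroup.eq_one_iff _).1 hx⟩ : N))
          exact congrArg Subtype.val this
        have hs := QuotientGroup.mk'_surjective N
        exact hX (PNilpotent.of_ker hc hk (ih _ (hqlt N hN1) (hZ.of_surjective fZ hs hc hk)
          (hJ.of_surjective fJ hs hc hk) rfl))
      not_pNilpotent := hX
      quotient := ih _ (hqlt U hU1) (SylowLocal.quotient fZ hsub U hUp hUmax)
        (SylowLocal.quotient fJ hsub U hUp hUmax) rfl }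
  exact hcrit.false_of_sylowLocal hp2 hZ hJ

end Thompson

/-! ### Groups whose maximal subgroups are nilpotent or of small index -/

section Main

open Subgroup

universe u

theorem Group.isSolvable_of_normal {G : Type*} [Group G] (N : Subgroup G) [N.Normal]
    (h1 : Group.IsSolvable N) (h2 : Group.IsSolvable (G ⧸ N)) : Group.IsSolvable G :=
  Group.isSolvable_of_ker_le_range N.subtype (QuotientGroup.mk' N) (by simp)

theorem IsPGroup.isSolvable {p : ℕ} [Fact p.Prime] {G : Type*} [Group G] [Finite G]
    (h : IsPGroup p G) : Group.IsSolvable G :=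
  have := h.isNilpotent
  inferInstance

theorem isSolvable_perm_of_card_eq_four {α : Type*} [Finite α] (h : Nat.card α = 4) :
    Group.IsSolvable (Equiv.Perm α) := by
  classical
  have := Fintype.ofFinite α
  have hα : Group.IsSolvable (alternatingGroup α) := by
    have hn := alternatingGroup.normal_kleinFour h
    have hc := alternatingGroup.kleinFour_card_of_card_eq_four h
    have h12 := alternatingGroup.card_of_card_eq_four h
    refine Group.isSolvable_of_normal (alternatingGroup.kleinFour α)
      (IsPGroup.of_card (p := 2) (n := 2) hc).isSolvable ?_
    have h3 : Nat.card (alternatingGroup α ⧸ alternatingGroup.kleinFour α) = 3 := by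
      have := card_mul_index (alternatingGroup.kleinFour α)
      rw [hc, h12] at this
      rw [← index_eq_card]
      omega
    have := Fact.mk Nat.prime_three
    exact (IsPGroup.of_card (p := 3) (n := 1) h3).isSolvable
  exact Group.isSolvable_of_ker_le_range (alternatingGroup α).subtype Equiv.Perm.sign
    (by rw [range_subtype]; exact le_rfl)

/-- A subgroup containing the normalizer of a Sylow `p`-subgroup has index `1` modulo `p`. -/
theorem index_modEq_one_of_normalizer_le {p : ℕ} [hp : Fact p.Prime] {X : Type*} [Group X] [Finite X]
    (S : Sylow p X) {H : Subgroup X} (hH : normalizer ((S : Subgroup X) : Set X) ≤ H) :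
    H.index ≡ 1 [MOD p] := by
  have hSH : (S : Subgroup X) ≤ H := le_normalizer.trans hH
  have h1 := card_sylow_modEq_one p X
  have h2 := card_sylow_modEq_one p H
  have h3 : (normalizer ((S.subtype hSH : Sylow p H) : Set H)).index =
      (normalizer ((S : Subgroup X) : Set X)).relIndex H := by
    rw [relIndex, subgroupOf, comap_normalizer_eq_of_le_range (by rwa [range_subtype])]
    rfl
  rw [(S.subtype hSH).card_eq_index_normalizer, h3] at h2
  have h5 : (normalizer (S : Set X)).index =
      (normalizer ((S : Subgroup X) : Set X)).relIndex H * H.index :=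
    (relIndex_mul_index hH).symm
  rw [S.card_eq_index_normalizer, h5] at h1
  have h4 := (h2.mul_right H.index).symm.trans h1
  simpa using h4

/-- The prime p divides (q - 1)(q + 1) and is at least q, so p = q + 1, and 2, 3 are the only
consecutive primes. -/
theorem eq_two_and_eq_three_of_sq_modEq_one {p q : ℕ} (hp : p.Prime) (hq : q.Prime) (hqp : q ≤ p)
    (h : q ^ 2 ≡ 1 [MOD p]) : q = 2 ∧ p = 3 := by
  have h1 : p ∣ q ^ 2 - 1 := (Nat.modEq_iff_dvd' (Nat.one_le_pow _ _ hq.pos)).1 h.symm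
  have h2 : q ^ 2 - 1 = (q + 1) * (q - 1) := by
    have := Nat.sq_sub_sq q 1
    simpa using this
  have hq2 := hq.two_le
  rw [h2, hp.dvd_mul] at h1
  have h3 : p = q + 1 := by
    rcases h1 with h1 | h1
    · rcases hqp.eq_or_lt with rfl | hlt
      · exact absurd ((Nat.dvd_add_right dvd_rfl).1 h1) hq.not_dvd_one
      · exact le_antisymm (Nat.le_of_dvd (by omega) h1) hlt
    · have := Nat.le_of_dvd (by omega) h1
      omega
  rcases hq.eq_two_or_odd' with rfl | ho
  · exact ⟨rfl, h3⟩
  · have h4 : Even p := by rw [h3]; exact ho.add_one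
    have := (hp.even_iff).1 h4
    omega

theorem prime_not_modEq_one {p q : ℕ} (hq : q.Prime) (hqp : q ≤ p)
    (h : q ≡ 1 [MOD p]) : False := by
  have h1 : p ∣ q - 1 := (Nat.modEq_iff_dvd' hq.one_le).1 h.symm
  have hq2 := hq.two_le
  have := Nat.le_of_dvd (by omega) h1
  omega

/-- Every maximal subgroup is nilpotent or has as index a prime or the square of a prime. -/
def MaximalNilpotentOrSmallIndex (G : Type*) [Group G] : Prop :=
  ∀ M : Subgroup G, IsCoatom M →
    Group.IsNilpotent M ∨ ∃ p : ℕ, p.Prime ∧ (M.index = p ∨ M.index = p ^ 2)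

theorem MaximalNilpotentOrSmallIndex.quotient {G : Type*} [Group G]
    (h : MaximalNilpotentOrSmallIndex G) (N : Subgroup G) [N.Normal] :
    MaximalNilpotentOrSmallIndex (G ⧸ N) := by
  intro M hM
  have hs := QuotientGroup.mk'_surjective N
  have hc : IsCoatom (M.comap (QuotientGroup.mk' N)) := isCoatom_comap_of_surjective hs hM
  rcases h _ hc with hn | ⟨p, hp, hi⟩
  · left
    have hsurj : Function.Surjective ((QuotientGroup.mk' N).subgroupComap M) :=
      (QuotientGroup.mk' N).subgroupComap_surjective_of_surjective M hs
    exact Group.nilpotent_of_surjective _ hsurj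
  · right
    rw [index_comap_of_surjective _ hs] at hi
    exact ⟨p, hp, hi⟩

theorem exists_max_prime_dvd {n : ℕ} (hn : n ≠ 0) (hn1 : n ≠ 1) :
    ∃ p, p.Prime ∧ p ∣ n ∧ ∀ q, q.Prime → q ∣ n → q ≤ p := by
  obtain ⟨p, hp, hmax⟩ := n.primeFactors.exists_max_image id (Nat.nonempty_primeFactors.2 (by omega))
  exact ⟨p, Nat.prime_of_mem_primeFactors hp, Nat.dvd_of_mem_primeFactors hp,
    fun q hq hd => hmax q (Nat.mem_primeFactors.2 ⟨hq, hd, hn⟩)⟩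

/-- In a group with the property, a minimal normal subgroup is solvable. -/
theorem MaximalNilpotentOrSmallIndex.isSolvable_of_minimal {G : Type u} [Group G] [Finite G]
    (h : MaximalNilpotentOrSmallIndex G) (N : Subgroup G) [hN : N.Normal]
    (hmin : ∀ D : Subgroup G, D.Normal → D ≤ N → D = ⊥ ∨ D = N) : Group.IsSolvable N := by
  by_contra hsol
  have hNp (r : ℕ) (hr : r.Prime) : ¬ IsPGroup r N := fun hc =>
    have := Fact.mk hr
    hsol hc.isSolvable
  have hchar (r : ℕ) (hr : r.Prime) (D : Subgroup G) (hD : IsPGroup r D) (hDN : D ≤ N)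
      (hD1 : D ≠ ⊥) : normalizer (D : Set G) ≠ ⊤ := fun ht => by
    rcases hmin D (normalizer_eq_top_iff.1 ht) hDN with rfl | rfl
    · exact hD1 rfl
    · exact hNp r hr hD
  have hcard1 : Nat.card N ≠ 1 := fun hc =>
    hNp 2 Nat.prime_two (IsPGroup.of_card (n := 0) (by rw [hc, pow_zero]))
  obtain ⟨p, hp, hpN, hpmax⟩ := exists_max_prime_dvd Nat.card_pos.ne' hcard1
  have := Fact.mk hp
  have hp2 : p ≠ 2 := by
    rintro rfl
    refine hNp 2 Nat.prime_two (IsPGroup.of_card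
      (Nat.eq_prime_pow_of_unique_prime_dvd Nat.card_pos.ne' fun {d} hd hd' => ?_))
    exact le_antisymm (hpmax d hd hd') hd.two_le
  have key (T : Sylow p N) : ∃ M : Subgroup G, IsCoatom M ∧ Group.IsNilpotent M ∧
      normalizer ((T : Subgroup N).map N.subtype : Set G) ≤ M := by
    set T' := (T : Subgroup N).map N.subtype with hT'
    have hT'1 : T' ≠ ⊥ := by
      rw [hT', Ne, map_eq_bot_iff_of_injective _ N.subtype_injective]
      exact T.ne_bot_of_dvd_card hpN
    obtain ⟨M, hM, hle⟩ := (eq_top_or_exists_le_coatom (normalizer (T' : Set G))).resolve_left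
      (hchar p hp T' (T.isPGroup'.map _) (map_subtype_le _) hT'1)
    refine ⟨M, hM, (h M hM).resolve_right ?_, hle⟩
    rintro ⟨q, hq, hidx⟩
    have hMN : M ⊔ N = ⊤ := by
      rw [← top_le_iff, ← Sylow.normalizer_sup_eq_top T]
      exact sup_le_sup_right hle N
    have hi : M.index = (M.subgroupOf N).index := index_eq_relIndex_of_sup_eq_top hMN
    have hmod : M.index ≡ 1 [MOD p] := by
      rw [hi]
      refine index_modEq_one_of_normalizer_le T fun x hx => ?_
      exact hle (le_normalizer_map N.subtype ⟨x, hx, rfl⟩)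
    have hqN : q ≤ p := by
      refine hpmax q hq (dvd_trans ?_ (M.subgroupOf N).index_dvd_card)
      rw [← hi]
      rcases hidx with hidx | hidx <;> rw [hidx]
      exact dvd_pow_self q two_ne_zero
    rcases hidx with hidx | hidx
    · exact prime_not_modEq_one hq hqN (hidx ▸ hmod)
    · obtain ⟨rfl, rfl⟩ := eq_two_and_eq_three_of_sq_modEq_one hp hq hqN (hidx ▸ hmod)
      have h4 : Nat.card (G ⧸ M) = 4 := by rw [← index_eq_card, hidx]; norm_num
      have hs4 := isSolvable_perm_of_card_eq_four h4
      -- By minimality, N acts faithfully on the four cosets of M, as N is not contained in M.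
      have hker : M.normalCore ⊓ N = ⊥ := by
        refine (hmin _ inferInstance inf_le_right).resolve_right fun he => hM.1 ?_
        have : N ≤ M := (inf_eq_right.1 he).trans M.normalCore_le
        rwa [sup_eq_left.2 this] at hMN
      refine hsol (Group.isSolvable_of_isSolvable_injective
        (f := (MulAction.toPermHom G (G ⧸ M)).comp N.subtype) ?_)
      rw [injective_iff_map_eq_one]
      intro x hx
      have hx' : (x : G) ∈ M.normalCore ⊓ N := by
        refine ⟨?_, x.2⟩
        rw [M.normalCore_eq_ker]
        exact hx
      rw [hker, mem_bot] at hx'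
      exact Subtype.ext hx'
  have hlocal (K : ∀ {X : Type u} [Group X], Subgroup X → Subgroup X)
      (hK : IsCharacteristicFunctor p @K) : SylowLocal p @K N := by
    intro T
    obtain ⟨M, hM, hMnil, hle⟩ := key T
    refine PNilpotent.normalizer_of_map N.subtype_injective _ ?_
    rw [← hK.map _ _ N.subtype_injective.injOn]
    set T' := (T : Subgroup N).map N.subtype with hT'
    have hT'p : IsPGroup p T' := T.isPGroup'.map _
    have hT'1 : T' ≠ ⊥ := by
      rw [hT', Ne, map_eq_bot_iff_of_injective _ N.subtype_injective]
      exact T.ne_bot_of_dvd_card hpN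
    have hT'M : T' ≤ M := le_normalizer.trans hle
    -- The Sylow p-subgroup R of the nilpotent group M is normal in M and meets N exactly in T'.
    have hMle : M ≤ normalizer (T' : Set G) := by
      obtain ⟨R, hR⟩ := (hT'p.comap_subtype (K := M)).exists_le_sylow
      have hRn : (R : Subgroup M).Normal := inferInstance
      have heq : (R : Subgroup M).map M.subtype ⊓ N = T' := by
        refine le_antisymm ?_ (le_inf (fun x hx => ⟨⟨x, hT'M hx⟩, hR hx, rfl⟩) (map_subtype_le _))
        have h1 : ((R : Subgroup M).map M.subtype).subgroupOf N = T := by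
          refine T.is_maximal' (R.isPGroup'.map M.subtype).comap_subtype fun x hx => ?_
          exact ⟨⟨x, hT'M ⟨x, hx, rfl⟩⟩, hR ⟨x, hx, rfl⟩, rfl⟩
        rw [← subgroupOf_map_subtype, h1]
      intro m hm
      refine mem_normalizer_of_forall_conj_mem fun z hz => ?_
      rw [← heq] at hz ⊢
      obtain ⟨⟨r, hr, rfl⟩, hzN⟩ := hz
      exact ⟨⟨_, hRn.conj_mem r hr ⟨m, hm⟩, rfl⟩, hN.conj_mem _ hzN m⟩
    have hKT : normalizer (K T' : Set G) = M := by
      by_contra hne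
      refine hchar p hp (K T') (hT'p.to_le (hK.le _)) ((hK.le _).trans (map_subtype_le _))
        (hK.ne_bot _ hT'p hT'1) (hM.2 _ (lt_of_le_of_ne ?_ (Ne.symm hne)))
      exact hMle.trans (hK.normalizer_le _)
    rw [hKT]
    exact PNilpotent.of_isNilpotent hp
  have hnil : PNilpotent p N := pNilpotent_of_sylowLocal hp2
    (hlocal _ (isCharacteristicFunctor_omegaCenter p))
    (hlocal _ (isCharacteristicFunctor_thompsonSubgroup p))
  have hmem (x : G) : x ∈ hnil.complement.map N.subtype ↔ x ∈ N ∧ PRegular p x := by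
    constructor
    · rintro ⟨c, hc, rfl⟩
      exact ⟨c.2, pRegular_coe.2 hc⟩
    · rintro ⟨hx, hx'⟩
      exact ⟨⟨x, hx⟩, pRegular_coe.1 hx', rfl⟩
  -- The p-complement of N is normal in G. If trivial, N is a p-group; if equal to N, p does not
  -- divide |N|.
  rcases hmin (hnil.complement.map N.subtype) ⟨fun x hx g => by
      rw [hmem] at hx ⊢
      exact ⟨hN.conj_mem x hx.1 g, hx.2.conj g⟩⟩ (map_subtype_le _) with h0 | h0
  · refine hNp p hp (isPGroup_of_pRegular_eq_one hp fun x hx hx' => ?_)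
    have := (hmem x).2 ⟨hx, hx'⟩
    rwa [h0, mem_bot] at this
  · refine not_dvd_card_of_pRegular hp (H := N) (fun x hx => ?_) hpN
    rw [← h0] at hx
    exact ((hmem x).1 hx).2

end Main

theorem theoremA {G : Type*} [Group G] [Finite G]
    (h : ∀ M : Subgroup G, IsCoatom M →
      Group.IsNilpotent M ∨ ∃ p : ℕ, p.Prime ∧ (M.index = p ∨ M.index = p ^ 2)) :
    Group.IsSolvable G := by
  change MaximalNilpotentOrSmallIndex G at h
  induction hn : Nat.card G using Nat.strong_induction_on generalizing G with
  | _ n ih =>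
  rcases subsingleton_or_nontrivial G with hG | hG
  · infer_instance
  obtain ⟨N, ⟨hN, hN1⟩, hmin⟩ := Set.exists_min_image
    {N : Subgroup G | N.Normal ∧ N ≠ ⊥} (fun N => Nat.card N) (Set.toFinite _)
    ⟨⊤, inferInstance, top_ne_bot⟩
  have hsol : Group.IsSolvable N := h.isSolvable_of_minimal N fun D hD hDN => by
    refine or_iff_not_imp_left.2 fun hD1 => ?_
    exact Subgroup.eq_of_le_of_card_ge hDN (hmin D ⟨hD, hD1⟩)
  refine Group.isSolvable_of_normal N hsol (ih _ ?_ (h.quotient N) rfl)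
  rw [← hn, ← Subgroup.index_eq_card, ← Subgroup.card_mul_index N]
  have h1 : 1 < Nat.card N := by rwa [Subgroup.one_lt_card_iff_ne_bot]
  have h2 : 0 < N.index := Nat.pos_of_ne_zero Subgroup.FiniteIndex.index_ne_zero
  nlinarith
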